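/- **Setting.** Let $\Sigma$ be an $L\times L$ positive semidefinite matrix, $D=(D_1,\dots,D_L)\in\mathbb R^L$, and let $\mathbf Y$ consist of $n$ independent drawings $(Y_{1,t},\dots,Y_{L,t})$, $t=1,\dots,n$, of a Gaussian vector $Y\sim\mathcal N(0,\Sigma)$. A scheme of block length $n$ consists of measurable encoders $\phi_j^{(n)}:\mathbb R^n\to\{1,\dots,M_j^{(n)}\}$, $1\le j\le L$, of rates $R_j^{(n)}=\frac1n\log_2 M_j^{(n)}$, where encoder $j$ sees only $\mathbf Y_j=(Y_{j,1},\dots,Y_{j,n})$, and of decoders $\psi_j^{(n)}:\prod_i\{1,\dots,M_i^{(n)}\}\to\mathbb R^n$ that give the reconstructions $\hat{\mathbf Y}_j$ from all $L$ messages. A tuple $(R_1,\dots,R_L)\in\mathbb R^L$ is *$(\Sigma,D)$-achievable* if there is a sequence of schemes, one for each $n$, with $\limsup_n R_j^{(n)}\le R_j$ and $\limsup_n\frac1n\sum_{t=1}^nE[(Y_{j,t}-\hat Y_{j,t})^2]\le D_j$ for all $j$. Let $R_{sum}(\Sigma,D)$ be the infimum of $\sum_jR_j$ over the closed convex hull of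 the set of achievable tuples. Let $\mathcal R^{BT}(\Sigma,D)$ be the set of all $(R_1,\dots,R_L)\in\mathbb R^L$ for which there are variances $\sigma_{Q_i}^2>0$ such that, with $Q_i\sim\mathcal N(0,\sigma_{Q_i}^2)$ independent of each other and of $Y$, and $U_i=Y_i+Q_i$, one has $E[(Y_i-E(Y_i\mid U_1,\dots,U_L))^2]\le D_i$ for all $i$ and $\sum_{i\in A}R_i\ge I(Y_A;U_A\mid U_{A^c})$ (in bits) for all $A\subseteq\{1,\dots,L\}$. Let $R_{sum}^{BT}(\Sigma,D)$ be the infimum of $\sum_iR_i$ over $\mathcal R^{BT}(\Sigma,D)$. Infima over the empty set are $+\infty$. **Block-degraded pairs.** The pair $(\Sigma,D)$ is *block-degraded* with induced pair $(\bar\Sigma,\bar D)$, where $\bar\Sigma$ is a $K\times K$ matrix and $\bar D\in\mathbb R^K$, if there are a partition of $\{1,\dots,L\}$ into $K$ sets $S_1,\dots,S_K$, leaders $i(k)\in S_k$, and an $L\times L$ diagonal matrix $\Sigma_Z$ with $[\Sigma_Z]_{j,j}=0$ if $j$ is a leader and $[\Sigma_Z]_{j,j}>0$ otherwise, such that $$\Sigma=G\bar\Sigma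 G^T+\Sigma_Z,\qquad D_{i(k)}=\bar D_k\ \ (1\le k\le K),\qquad D_j\ge\bar D_k+[\Sigma_Z]_{j,j}\ \ (1\le k\le K,\ j\in S_k\setminus\{i(k)\}),$$ where $G$ is the $L\times K$ matrix with $G_{j,k}=1$ if $j\in S_k$ and $G_{j,k}=0$ otherwise. (That is, each source is the leader of its group plus noise, the noises being independent of each other and of all the leaders; $\bar\Sigma$ is the covariance matrix of the leaders.) **Lemma.** Let $(\Sigma,D)$ be block-degraded with induced pair $(\bar\Sigma,\bar D)$. If $R_{sum}(\bar\Sigma,\bar D)=R_{sum}^{BT}(\bar\Sigma,\bar D)$, then $$R_{sum}(\Sigma,D)=R_{sum}^{BT}(\Sigma,D)=R_{sum}^{BT}(\bar\Sigma,\bar D).$$ -/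

import Mathlib

open MeasureTheory ProbabilityTheory Filter
open scoped ENNReal NNReal

noncomputable section

namespace MTCoding

/-! ### Multiterminal source coding with quadratic distortion -/

/-- The law of `n` independent drawings of the Gaussian vector `Y ~ N(0, S)`, where `S` is an
`L × L` covariance matrix. A sample `y` has entries `y t j` (time `t`, terminal `j`). -/
def blockLaw {L : ℕ} (S : Matrix (Fin L) (Fin L) ℝ) (n : ℕ) :
    Measure (Fin n → EuclideanSpace ℝ (Fin L)) :=
  Measure.pi fun _ => multivariateGaussian 0 S

/-- A coding scheme of block length `n` for `L` terminals: encoder `j` sees only the `j`-th block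
and sends one of `M j` messages; the decoder sees all the messages and reconstructs each block. -/
structure Scheme (L n : ℕ) where
  M : Fin L → ℕ
  enc : ∀ j, (Fin n → ℝ) → Fin (M j)
  measurable_enc : ∀ j, Measurable (enc j)
  dec : ∀ _ : Fin L, (∀ i, Fin (M i)) → Fin n → ℝ

namespace Scheme

variable {L n : ℕ}

/-- Rate of the `j`-th encoder in bits per source sample. -/
def rate (c : Scheme L n) (j : Fin L) : ℝ := Real.logb 2 (c.M j) / n

/-- The transmitted symbols `W = (W_1, …, W_L)`. -/
def messages (c : Scheme L n) (y : Fin n → EuclideanSpace ℝ (Fin L)) : ∀ i, Fin (c.M i) :=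
  fun i => c.enc i fun t => y t i

/-- Average mean squared error in the reconstruction of the `j`-th source. -/
def distortion (c : Scheme L n) (S : Matrix (Fin L) (Fin L) ℝ) (j : Fin L) : ℝ :=
  (1 / (n : ℝ)) * ∑ t : Fin n, ∫ y, (y t j - c.dec j (c.messages y) t) ^ 2 ∂(blockLaw S n)

end Scheme

/-- The rate tuple `R` is `(S, D)`-achievable. -/
def IsAchievable {L : ℕ} (S : Matrix (Fin L) (Fin L) ℝ) (D R : Fin L → ℝ) : Prop :=
  ∃ c : ∀ n : ℕ, Scheme L n,
    (∀ j, limsup (fun n => (((c n).rate j : ℝ) : EReal)) atTop ≤ ((R j : ℝ) : EReal)) ∧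
    (∀ j, limsup (fun n => (((c n).distortion S j : ℝ) : EReal)) atTop ≤ ((D j : ℝ) : EReal))

/-- The achievable rate region: convex closure of the set of achievable rate tuples. -/
def rateRegion {L : ℕ} (S : Matrix (Fin L) (Fin L) ℝ) (D : Fin L → ℝ) : Set (Fin L → ℝ) :=
  closedConvexHull ℝ {R | IsAchievable S D R}

/-- The minimum sum-rate (`⊤` if no rate tuple is achievable). -/
def minSumRate {L : ℕ} (S : Matrix (Fin L) (Fin L) ℝ) (D : Fin L → ℝ) : EReal :=
  ⨅ R ∈ rateRegion S D, ((∑ j, R j : ℝ) : EReal)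

/-! ### The Berger–Tung inner region with parallel Gaussian test channels -/

/-- Conditional mutual information `I(X; V | W)` in bits: the Kullback–Leibler divergence of the
joint law of `(W, X, V)` from the law under which `X` and `V` are conditionally independent given
`W` with the same conditional marginals. -/
def condMutualInfo {Ω α β γ : Type*} [MeasurableSpace Ω]
    [MeasurableSpace α] [StandardBorelSpace α] [Nonempty α]
    [MeasurableSpace β] [StandardBorelSpace β] [Nonempty β] [MeasurableSpace γ]
    (X : Ω → α) (V : Ω → β) (W : Ω → γ) (μ : Measure Ω) [IsFiniteMeasure μ] : ℝ≥0∞ :=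
  InformationTheory.klDiv (μ.map fun ω => (W ω, X ω, V ω))
      ((μ.map W) ⊗ₘ (condDistrib X W μ ×ₖ condDistrib V W μ)) /
    ENNReal.ofReal (Real.log 2)

/-- Sample space of the pair `(Y, Q)`: source vector and test-channel noise vector. -/
abbrev TestSpace (L : ℕ) : Type := EuclideanSpace ℝ (Fin L) × (Fin L → ℝ)

/-- Law of `(Y, Q)`: `Y ~ N(0, S)`, `Q_i ~ N(0, q i)`, with `Y, Q_1, …, Q_L` independent. -/
abbrev testLaw {L : ℕ} (S : Matrix (Fin L) (Fin L) ℝ) (q : Fin L → ℝ≥0) :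
    Measure (TestSpace L) :=
  (multivariateGaussian 0 S).prod (Measure.pi fun i => gaussianReal 0 (q i))

/-- The auxiliary vector `U = Y + Q`. -/
def auxU {L : ℕ} (ω : TestSpace L) : Fin L → ℝ := fun i => ω.1 i + ω.2 i

/-- The subvector `Y_A`. -/
def subY {L : ℕ} (A : Finset (Fin L)) (ω : TestSpace L) : A → ℝ := fun i => ω.1 i

/-- The subvector `U_A`. -/
def subU {L : ℕ} (A : Finset (Fin L)) (ω : TestSpace L) : A → ℝ := fun i => auxU ω i

/-- The test channel with noise variances `q` is admissible: all variances are positive and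
`E (Y_i - E(Y_i | U))² ≤ D_i` for all `i`. -/
def IsAdmissible {L : ℕ} (S : Matrix (Fin L) (Fin L) ℝ) (D : Fin L → ℝ) (q : Fin L → ℝ≥0) :
    Prop :=
  (∀ i, 0 < q i) ∧
  ∀ i, ∫ ω, (ω.1 i - ((testLaw S q)[fun ω' : TestSpace L => ω'.1 i |
    MeasurableSpace.comap auxU inferInstance]) ω) ^ 2 ∂(testLaw S q) ≤ D i

/-- The Berger–Tung rate region: union over the admissible test channels of the sets of rate
tuples with `∑_{i ∈ A} R_i ≥ I(Y_A; U_A | U_{Aᶜ})` for all `A`. -/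
def btRegion {L : ℕ} (S : Matrix (Fin L) (Fin L) ℝ) (D : Fin L → ℝ) : Set (Fin L → ℝ) :=
  {R | ∃ q : Fin L → ℝ≥0, IsAdmissible S D q ∧ ∀ A : Finset (Fin L),
    ((condMutualInfo (subY A) (subU A) (subU Aᶜ) (testLaw S q) : ℝ≥0∞) : EReal) ≤
      ((∑ i ∈ A, R i : ℝ) : EReal)}

/-- The Berger–Tung minimum sum-rate (`⊤` if the Berger–Tung region is empty). -/
def btMinSumRate {L : ℕ} (S : Matrix (Fin L) (Fin L) ℝ) (D : Fin L → ℝ) : EReal :=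
  ⨅ R ∈ btRegion S D, ((∑ j, R j : ℝ) : EReal)

/-! ### Block-degraded pairs -/

/-- The `L × K` matrix with `(j, k)` entry one if `j` lies in group `k` and zero otherwise. -/
def groupMatrix {L K : ℕ} (g : Fin L → Fin K) : Matrix (Fin L) (Fin K) ℝ :=
  Matrix.of fun j k => if g j = k then 1 else 0

/-- `(S, D)` is block-degraded with induced pair `(S', D')`. The partition is into the groups
`{j | g j = k}`, `lead k` is the leader of group `k`, and `z j` is the variance of the noise that
is added to the leader of its group to give source `j`. -/
structure IsBlockDegraded {L K : ℕ} (S : Matrix (Fin L) (Fin L) ℝ) (D : Fin L → ℝ)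
    (S' : Matrix (Fin K) (Fin K) ℝ) (D' : Fin K → ℝ)
    (g : Fin L → Fin K) (lead : Fin K → Fin L) (z : Fin L → ℝ) : Prop where
  lead_mem : ∀ k, g (lead k) = k
  noise_lead : ∀ k, z (lead k) = 0
  noise_pos : ∀ j, j ≠ lead (g j) → 0 < z j
  cov_eq : S = groupMatrix g * S' * (groupMatrix g).transpose + Matrix.diagonal z
  dist_lead : ∀ k, D (lead k) = D' k
  dist_ge : ∀ j, j ≠ lead (g j) → D' (g j) + z j ≤ D j

end MTCoding

end

/-! Two equalities are proved separately: passing to the leaders changes neither the operational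
minimum sum-rate nor the Berger–Tung one. Tightness for the induced pair then joins them.

Operational side. A code for the leaders serves all sources: non-leaders send nothing, and each
source is reconstructed as its leader, with the noise variance added to the error
(`isAchievable_of_lead`). Conversely, the encoder of a leader can imitate its whole group by adding
a fixed noise block to what it sees. Each noise block gives a tuple of leader distortions, and the
mean of these tuples is that of the original code. No single block need be good for all leaders at
once, but at fixed rates the achievable distortion tuples form a closed convex set, which contains
the mean (`isAchievable_induced`).

Berger–Tung side. For Gaussian test channels the mutual informations are log-determinant ratios in
the weights `1 / q i` (`condMutualInfo_testLaw`). The channels of one group observe the same leader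
through independent noises of variances `q j + z j`. They are equivalent, for estimating the leader,
to one channel whose inverse variance is the sum of theirs. Merging preserves admissibility
(`isAdmissible_mergedVar`) and does not raise the information (`infoNats_mergedVar_le`). Conversely,
leader channels are completed by very noisy channels for the other sources. Their weights tend to
zero, so by continuity the additional rate is arbitrarily small (`exists_mem_btRegion`). -/

open MeasureTheory ProbabilityTheory Filter
open scoped ENNReal NNReal

noncomputable section

namespace MTCoding

/-! ### Determinants of the form `det (1 + M Λ)` with `Λ` diagonal -/

section Determinants

variable {ι κ : Type*} [Fintype ι] [DecidableEq ι] [Fintype κ] [DecidableEq κ]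

/-- Pulling a matrix back along `e` amounts to adding up the diagonal weights over the fibres. -/
lemma det_one_add_submatrix_mul_diagonal (e : ι → κ) (M : Matrix κ κ ℝ) (w : ι → ℝ) :
    (1 + M.submatrix e e * Matrix.diagonal w).det =
      (1 + M * Matrix.diagonal fun k => ∑ i, if e i = k then w i else 0).det := by
  -- `G` is the indicator matrix of `e`, so the pulled-back matrix is `G * M * Gᵀ`. Sylvester's
  -- identity `det (1 + A * B) = det (1 + B * A)` moves `G` to the right, where `Gᵀ * diagonal w *
  -- G` is diagonal with the fibre sums.
  set G : Matrix ι κ ℝ := Matrix.of fun i k => if e i = k then 1 else 0 with hG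
  have h1 : M.submatrix e e * Matrix.diagonal w = G * (M * G.transpose * Matrix.diagonal w) := by
    ext i j
    simp [hG, Matrix.mul_apply, Matrix.diagonal_apply, ← mul_assoc]
  have h2 : M * G.transpose * Matrix.diagonal w * G =
      M * Matrix.diagonal fun k => ∑ i, if e i = k then w i else 0 := by
    rw [Matrix.mul_assoc, Matrix.mul_assoc]
    congr 1
    ext k l
    rw [Matrix.mul_apply]
    simp only [hG, Matrix.diagonal_mul, Matrix.diagonal_apply, Matrix.transpose_apply,
      Matrix.of_apply]
    by_cases hkl : k = l
    · subst hkl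
      simp only [if_true]
      refine Finset.sum_congr rfl fun i _ => ?_
      by_cases hi : e i = k <;> simp [hi]
    · simp only [hkl, if_false]
      refine Finset.sum_eq_zero fun i _ => ?_
      by_cases hi : e i = k
      · simp [hi, hkl]
      · simp [hi]
  rw [h1, Matrix.det_one_add_mul_comm, h2]

/-- With `r = diagonal √w`, Sylvester's identity replaces the non-symmetric matrix by `1 + r * M *
r`, which is positive definite. Zero weights are allowed; they stand for test channels with infinite
noise. -/
lemma det_one_add_mul_diagonal_pos {M : Matrix ι ι ℝ} (hM : M.PosSemidef) {w : ι → ℝ}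
    (hw : ∀ i, 0 ≤ w i) : 0 < (1 + M * Matrix.diagonal w).det := by
  set r : Matrix ι ι ℝ := Matrix.diagonal fun i => √(w i) with hr
  have h1 : Matrix.diagonal w = r * r := by
    simp [hr, Matrix.diagonal_mul_diagonal, Real.mul_self_sqrt (hw _)]
  have h2 : r.conjTranspose = r := by simp [hr]
  rw [h1, ← Matrix.mul_assoc, Matrix.det_one_add_mul_comm, ← Matrix.mul_assoc]
  have h3 : (r * M * r).PosSemidef := by
    have := hM.mul_mul_conjTranspose_same r
    rwa [h2] at this
  exact (Matrix.PosDef.one.add_posSemidef h3).det_pos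

lemma det_add_diagonal (M : Matrix ι ι ℝ) {q : ι → ℝ} (hq : ∀ i, q i ≠ 0) :
    (M + Matrix.diagonal q).det =
      (1 + M * Matrix.diagonal fun i => (q i)⁻¹).det * ∏ i, q i := by
  rw [← Matrix.det_diagonal, ← Matrix.det_mul, add_mul, one_mul, Matrix.mul_assoc,
    Matrix.diagonal_mul_diagonal]
  simp [hq, add_comm]

/-- Source noise `z i` followed by channel noise of weight `w i = 1 / q i` acts as one channel of
weight `w i / (1 + z i * w i) = 1 / (q i + z i)`. The left-hand form still makes sense for `w i =
0`. -/
lemma det_one_add_add_diagonal_mul (M : Matrix ι ι ℝ) {z w : ι → ℝ}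
    (h : ∀ i, 1 + z i * w i ≠ 0) :
    (1 + (M + Matrix.diagonal z) * Matrix.diagonal w).det =
      (1 + M * Matrix.diagonal fun i => w i / (1 + z i * w i)).det * ∏ i, (1 + z i * w i) := by
  rw [← Matrix.det_diagonal, ← Matrix.det_mul, add_mul, add_mul, one_mul, Matrix.mul_assoc,
    Matrix.diagonal_mul_diagonal, Matrix.diagonal_mul_diagonal]
  simp only [div_mul_cancel₀ _ (h _)]
  rw [show (Matrix.diagonal fun i => 1 + z i * w i) = 1 + Matrix.diagonal fun i => z i * w i by
    rw [← Matrix.diagonal_one, Matrix.diagonal_add]]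
  congr 1
  abel

end Determinants

/-! ### Densities and differential entropies of Gaussian vectors -/

/-- Minus the differential entropy (in nats) of the standard normal law. -/
def stdLogPDFMean : ℝ := ∫ x, Real.log (gaussianPDFReal 0 1 x) ∂(gaussianReal 0 1)

lemma integrable_log_gaussianPDFReal :
    Integrable (fun x => Real.log (gaussianPDFReal 0 1 x)) (gaussianReal 0 1) := by
  have h : (fun x => Real.log (gaussianPDFReal 0 1 x)) =
      fun x => Real.log (√(2 * Real.pi * 1))⁻¹ - x ^ 2 / 2 := by
    ext x
    rw [gaussianPDFReal, Real.log_mul (by positivity) (by positivity), Real.log_exp]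
    simp
    ring
  rw [h]
  have h2 : MemLp id 2 (gaussianReal 0 1) := memLp_id_gaussianReal 2
  exact (integrable_const _).sub (h2.integrable_sq.div_const 2)

section Density

variable {ι : Type*} [Fintype ι] 

lemma pi_gaussianReal_eq_withDensity :
    (Measure.pi fun _ : ι => gaussianReal 0 1) =
      (volume : Measure (ι → ℝ)).withDensity fun x => ∏ i, gaussianPDF 0 1 (x i) := by
  refine Measure.pi_eq (μ := fun _ : ι => gaussianReal 0 1) fun s hs => ?_
  have hint : ∀ i, Integrable (gaussianPDFReal 0 1) (volume.restrict (s i)) := fun i =>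
    (integrable_gaussianPDFReal 0 1).integrableOn
  have hp : ∀ x : ι → ℝ, ∏ i, gaussianPDF 0 1 (x i) =
      ENNReal.ofReal (∏ i, gaussianPDFReal 0 1 (x i)) := fun x => by
    rw [ENNReal.ofReal_prod_of_nonneg fun i _ => gaussianPDFReal_nonneg _ _ _]
    rfl
  rw [withDensity_apply _ (MeasurableSet.univ_pi hs), volume_pi, Measure.restrict_pi_pi]
  simp_rw [hp]
  rw [← ofReal_integral_eq_lintegral_ofReal
      (Integrable.fintype_prod (f := fun _ => gaussianPDFReal 0 1) hint)
      (ae_of_all _ fun x => Finset.prod_nonneg fun i _ => gaussianPDFReal_nonneg _ _ _),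
    integral_fintype_prod_eq_prod (f := fun _ => gaussianPDFReal 0 1),
    ENNReal.ofReal_prod_of_nonneg fun i _ => integral_nonneg fun x => gaussianPDFReal_nonneg _ _ _]
  refine Finset.prod_congr rfl fun i _ => ?_
  rw [gaussianReal_apply_eq_integral _ one_ne_zero]

variable [DecidableEq ι]

/-- The centred Gaussian law with covariance matrix `T` on the function space `ι → ℝ`. -/
def piGaussian (T : Matrix ι ι ℝ) : Measure (ι → ℝ) :=
  (multivariateGaussian 0 T).map (WithLp.ofLp (p := 2))

instance (T : Matrix ι ι ℝ) : IsProbabilityMeasure (piGaussian T) :=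
  Measure.isProbabilityMeasure_map (by fun_prop)

/-- A nondegenerate Gaussian vector has a positive density whose logarithm is integrable. -/
lemma exists_density_piGaussian {T : Matrix ι ι ℝ} (hT : T.PosDef) :
    ∃ p : (ι → ℝ) → ℝ, Measurable p ∧ (∀ x, 0 < p x) ∧
      piGaussian T = volume.withDensity (fun x => ENNReal.ofReal (p x)) ∧
      Integrable (fun x => Real.log (p x)) (piGaussian T) ∧
      ∫ x, Real.log (p x) ∂(piGaussian T) =
        Fintype.card ι * stdLogPDFMean - Real.log T.det / 2 := by
  open scoped MatrixOrder in
  -- The Gaussian law is the image of the standard one under the square root `B` of `T`, so its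
  -- density is `|det B|⁻¹ φ(B⁻¹ x)`, with `φ` the standard density.
  obtain ⟨B, hB⟩ : ∃ B : Matrix ι ι ℝ, B = CFC.sqrt T := ⟨_, rfl⟩
  have hBB : B * B = T := by
    rw [hB]; exact CFC.sqrt_mul_sqrt_self _ hT.posSemidef.nonneg
  have hdet : B.det * B.det = T.det := by rw [← Matrix.det_mul, hBB]
  have hdet0 : B.det ≠ 0 := fun h => hT.det_pos.ne' (by rw [← hdet, h, zero_mul])
  have hu : IsUnit B.det := hdet0.isUnit
  have hinv : ∀ x : ι → ℝ, B⁻¹.mulVec (B.mulVec x) = x := fun x => by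
    rw [Matrix.mulVec_mulVec, Matrix.nonsing_inv_mul _ hu, Matrix.one_mulVec]
  have hmB : ∀ M : Matrix ι ι ℝ, Measurable fun x : ι → ℝ => M.mulVec x := fun M => by
    have : Continuous fun x : ι → ℝ => M.mulVec x := by fun_prop
    exact this.measurable
  set γ : Measure (ι → ℝ) := Measure.pi fun _ : ι => gaussianReal 0 1 with hγ
  have hlaw : piGaussian T = γ.map fun x => B.mulVec x := by
    rw [piGaussian, multivariateGaussian, ← hB, ← map_pi_eq_stdGaussian,
      Measure.map_map (by fun_prop) (by fun_prop), Measure.map_map (by fun_prop) (by fun_prop)]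
    congr 1
    ext x i
    simp [Function.comp]
  set φ : (ι → ℝ) → ℝ := fun x => ∏ i, gaussianPDFReal 0 1 (x i) with hφ
  have hφpos : ∀ x, 0 < φ x := fun x =>
    Finset.prod_pos fun i _ => gaussianPDFReal_pos _ _ _ one_ne_zero
  have hφm : Measurable φ := by
    refine Finset.measurable_prod _ fun i _ => ?_
    exact (measurable_gaussianPDFReal 0 1).comp (measurable_pi_apply i)
  have hlogφ : ∀ x, Real.log (φ x) = ∑ i, Real.log (gaussianPDFReal 0 1 (x i)) := fun x => by
    rw [hφ, Real.log_prod fun i _ => (gaussianPDFReal_pos _ _ _ one_ne_zero).ne']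
  have hint : ∀ i, Integrable (fun x : ι → ℝ => Real.log (gaussianPDFReal 0 1 (x i))) γ :=
    fun i => integrable_comp_eval (μ := fun _ : ι => gaussianReal 0 1) (i := i)
      integrable_log_gaussianPDFReal
  have hintφ : Integrable (fun x => Real.log (φ x)) γ := by
    simp_rw [hlogφ]
    exact integrable_finsetSum _ fun i _ => hint i
  have hlogp : ∀ x, Real.log (|B.det|⁻¹ * φ (B⁻¹.mulVec (B.mulVec x))) =
      -Real.log |B.det| + Real.log (φ x) := fun x => by
    rw [hinv, Real.log_mul (by positivity) (hφpos x).ne', Real.log_inv]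
  have hlogm : Measurable fun x => Real.log (|B.det|⁻¹ * φ (B⁻¹.mulVec x)) :=
    ((hφm.comp (hmB _)).const_mul _).log
  refine ⟨fun x => |B.det|⁻¹ * φ (B⁻¹.mulVec x), by
      exact (hφm.comp (hmB _)).const_mul _, fun x => by have := hφpos (B⁻¹.mulVec x); positivity,
      ?_, ?_, ?_⟩
  · rw [hlaw]
    ext s hs
    rw [Measure.map_apply (hmB B) hs, hγ, pi_gaussianReal_eq_withDensity,
      withDensity_apply _ (hmB B hs), withDensity_apply _ hs]
    have hv : (volume : Measure (ι → ℝ)) =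
        ENNReal.ofReal |B.det| • (volume : Measure (ι → ℝ)).map fun x => B.mulVec x := by
      have := Real.map_matrix_volume_pi_eq_smul_volume_pi hdet0
      rw [show (fun x => B.mulVec x) = ⇑(Matrix.toLin' B) by ext; simp, this, smul_smul,
        ← ENNReal.ofReal_mul (abs_nonneg _), ← abs_mul, mul_inv_cancel₀ hdet0]
      simp
    have hm2 : Measurable fun x => ENNReal.ofReal (|B.det|⁻¹ * φ (B⁻¹.mulVec x)) :=
      ((hφm.comp (hmB _)).const_mul _).ennreal_ofReal
    conv_rhs => rw [hv]
    rw [Measure.restrict_smul, lintegral_smul_measure, setLIntegral_map hs hm2 (hmB B),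
      smul_eq_mul, ← lintegral_const_mul _ (by exact hm2.comp (hmB B))]
    refine lintegral_congr fun x => ?_
    rw [← ENNReal.ofReal_mul (abs_nonneg _), hinv, ← mul_assoc,
      mul_inv_cancel₀ (abs_ne_zero.2 hdet0), one_mul, hφ,
      ENNReal.ofReal_prod_of_nonneg fun i _ => gaussianPDFReal_nonneg _ _ _]
    rfl
  · rw [hlaw, integrable_map_measure hlogm.aestronglyMeasurable (hmB B).aemeasurable]
    refine ((integrable_const (-Real.log |B.det|)).add hintφ).congr (ae_of_all _ fun x => ?_)
    simp only [Function.comp, hlogp, Pi.add_apply]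
  · rw [hlaw, integral_map (hmB B).aemeasurable hlogm.aestronglyMeasurable]
    simp_rw [hlogp]
    rw [integral_add (integrable_const _) hintφ, integral_const]
    simp_rw [hlogφ]
    rw [integral_finsetSum _ fun i _ => hint i, ← hdet, Real.log_mul hdet0 hdet0]
    have h1 : ∀ i, ∫ x, Real.log (gaussianPDFReal 0 1 (x i)) ∂γ = stdLogPDFMean := fun i =>
      integral_comp_eval (μ := fun _ : ι => gaussianReal 0 1) (i := i)
        integrable_log_gaussianPDFReal.aestronglyMeasurable
    simp [h1, Real.log_abs]
    ring

end Density

/-! ### Conditional mutual information through densities -/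

section KL

/-- Data processing, applied to `e` and to its inverse. -/
lemma klDiv_map_measurableEquiv {α β : Type*} [MeasurableSpace α] [MeasurableSpace β]
    (e : α ≃ᵐ β) (μ ν : Measure α) [IsFiniteMeasure μ] [IsFiniteMeasure ν] :
    InformationTheory.klDiv (μ.map e) (ν.map e) = InformationTheory.klDiv μ ν := by
  refine le_antisymm (InformationTheory.klDiv_map_le _ _ e.measurable) ?_
  have := InformationTheory.klDiv_map_le (μ.map e) (ν.map e) e.symm.measurable
  simpa [Measure.map_map e.symm.measurable e.measurable] using this

/-- Kullback–Leibler divergence of two laws with positive densities. -/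
lemma klDiv_withDensity {α : Type*} [MeasurableSpace α] {m P R : Measure α}
    [IsProbabilityMeasure P] [IsProbabilityMeasure R] {k r : α → ℝ}
    (hk : Measurable k) (hr : Measurable r) (hk0 : ∀ x, 0 < k x) (hr0 : ∀ x, 0 < r x)
    (hP : P = m.withDensity fun x => ENNReal.ofReal (k x))
    (hR : R = m.withDensity fun x => ENNReal.ofReal (r x))
    (ik : Integrable (fun x => Real.log (k x)) P) (ir : Integrable (fun x => Real.log (r x)) P) :
    InformationTheory.klDiv P R =
        ENNReal.ofReal (∫ x, Real.log (k x) ∂P - ∫ x, Real.log (r x) ∂P) ∧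
      0 ≤ ∫ x, Real.log (k x) ∂P - ∫ x, Real.log (r x) ∂P := by
  have hkr : Measurable fun x => ENNReal.ofReal (k x / r x) := (hk.div hr).ennreal_ofReal
  have hPR : P = R.withDensity fun x => ENNReal.ofReal (k x / r x) := by
    rw [hR, ← withDensity_mul _ hr.ennreal_ofReal hkr, hP]
    congr 1
    ext x
    simp only [Pi.mul_apply]
    rw [← ENNReal.ofReal_mul (hr0 x).le, mul_div_cancel₀ _ (hr0 x).ne']
  have hac : P ≪ R := hPR ▸ withDensity_absolutelyContinuous _ _
  have hrn : ∀ᵐ x ∂P, llr P R x = Real.log (k x) - Real.log (r x) := by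
    have h1 : P.rnDeriv R =ᵐ[R] fun x => ENNReal.ofReal (k x / r x) := by
      conv_lhs => rw [hPR]
      exact Measure.rnDeriv_withDensity R hkr
    filter_upwards [hac.ae_le h1] with x hx
    rw [llr_def]
    simp only
    rw [hx, ENNReal.toReal_ofReal (div_pos (hk0 x) (hr0 x)).le,
      Real.log_div (hk0 x).ne' (hr0 x).ne']
  have hint : Integrable (llr P R) P := (ik.sub ir).congr (hrn.mono fun x hx => hx.symm)
  have hval : ∫ x, llr P R x ∂P = ∫ x, Real.log (k x) ∂P - ∫ x, Real.log (r x) ∂P := by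
    rw [integral_congr_ae hrn, integral_sub ik ir]
  have hreal := InformationTheory.toReal_klDiv hac hint
  -- Both total masses are one, so the mass correction in the divergence vanishes.
  simp only [measureReal_def, measure_univ, add_sub_cancel_right] at hreal
  rw [← hval, ← hreal]
  exact ⟨(ENNReal.ofReal_toReal (InformationTheory.klDiv_ne_top hac hint)).symm,
    ENNReal.toReal_nonneg⟩

variable {Ω α β γ : Type*} [MeasurableSpace Ω]
    [MeasurableSpace α] [StandardBorelSpace α] [Nonempty α]
    [MeasurableSpace β] [StandardBorelSpace β] [Nonempty β] [MeasurableSpace γ]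

/-- If `V` has a conditional density given `W`, then it gives the law of the conditionally
independent coupling of `X` and `V` given `W`. -/
lemma compProd_condDistrib_prod_eq {X : Ω → α} {V : Ω → β} {W : Ω → γ} (hX : Measurable X)
    (hV : Measurable V) (hW : Measurable W) (P : Measure Ω) [IsProbabilityMeasure P]
    (lam : Measure β) [SigmaFinite lam] {r : γ × β → ℝ≥0∞} (hr : Measurable r)
    (hlaw : P.map (fun ω => (W ω, V ω)) = ((P.map W).prod lam).withDensity r) :
    (P.map W) ⊗ₘ (condDistrib X W P ×ₖ condDistrib V W P) =
      (((P.map fun ω => (W ω, X ω)).prod lam).withDensity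
        fun x => r (x.1.1, x.2)).map MeasurableEquiv.prodAssoc := by
  have : IsProbabilityMeasure (P.map W) := Measure.isProbabilityMeasure_map hW.aemeasurable
  have : IsProbabilityMeasure (P.map fun ω => (W ω, X ω)) :=
    Measure.isProbabilityMeasure_map (by fun_prop)
  have hcV : P.map (fun ω => (W ω, V ω)) = (P.map W) ⊗ₘ condDistrib V W P :=
    (compProd_map_condDistrib hV.aemeasurable).symm
  have hcX : P.map (fun ω => (W ω, X ω)) = (P.map W) ⊗ₘ condDistrib X W P :=
    (compProd_map_condDistrib hX.aemeasurable).symm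
  -- The exceptional null set may depend on `u`: only measurable boxes are compared below.
  have hae : ∀ u, MeasurableSet u → ∀ᵐ w ∂(P.map W), condDistrib V W P w u =
      ∫⁻ v in u, r (w, v) ∂lam := by
    intro u hu
    refine ae_eq_of_forall_setLIntegral_eq_of_sigmaFinite
      (Kernel.measurable_coe _ hu) hr.lintegral_prod_right' fun s hs _ => ?_
    have h1 := Measure.compProd_apply_prod (μ := P.map W) (κ := condDistrib V W P) hs hu
    rw [← h1, ← hcV, hlaw, withDensity_apply _ (hs.prod hu), ← Measure.prod_restrict,
      lintegral_prod _ hr.aemeasurable]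
  refine Measure.ext_prod₃ fun {s t u} hs ht hu => ?_
  rw [Measure.map_apply MeasurableEquiv.prodAssoc.measurable (hs.prod (ht.prod hu)),
    Measure.compProd_apply_prod hs (ht.prod hu)]
  have hpre : (MeasurableEquiv.prodAssoc : (γ × α) × β ≃ᵐ γ × α × β) ⁻¹' (s ×ˢ t ×ˢ u) =
      (s ×ˢ t) ×ˢ u := by
    ext ⟨⟨a, b⟩, c⟩
    simp [MeasurableEquiv.prodAssoc, and_assoc]
  have hr' : Measurable fun x : (γ × α) × β => r (x.1.1, x.2) := by fun_prop
  have hr'' : Measurable fun x : γ × α => ∫⁻ v in u, r (x.1, v) ∂lam :=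
    Measurable.lintegral_prod_right' (f := fun x : (γ × α) × β => r (x.1.1, x.2)) hr'
  rw [hpre, withDensity_apply _ ((hs.prod ht).prod hu), ← Measure.prod_restrict,
    lintegral_prod _ hr'.aemeasurable, hcX, Measure.setLIntegral_compProd hr'' hs ht]
  refine setLIntegral_congr_fun_ae hs ?_
  filter_upwards [hae u hu] with w hw _
  rw [Kernel.prod_apply, Measure.prod_prod, hw, setLIntegral_const, mul_comm]

/-- This is `I = h(V | W) - h(V | X)`. Given `(W, X)` the density `k` of `V` depends on `X` alone,
and given `W` the density is `r`. Both laws in the divergence then have densities with respect to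
the law of `(W, X)` times `lam`. No density of `X` is needed, so degenerate sources are covered. -/
lemma condMutualInfo_eq_of_density {X : Ω → α} {V : Ω → β} {W : Ω → γ} (hX : Measurable X)
    (hV : Measurable V) (hW : Measurable W) (P : Measure Ω) [IsProbabilityMeasure P]
    (lam : Measure β) [SigmaFinite lam] {k : α × β → ℝ} {r : γ × β → ℝ} (hk : Measurable k)
    (hr : Measurable r) (hk0 : ∀ x, 0 < k x) (hr0 : ∀ x, 0 < r x)
    (hlawk : P.map (fun ω => ((W ω, X ω), V ω)) =
      ((P.map fun ω => (W ω, X ω)).prod lam).withDensity fun x => ENNReal.ofReal (k (x.1.2, x.2)))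
    (hlawr : P.map (fun ω => (W ω, V ω)) =
      ((P.map W).prod lam).withDensity fun x => ENNReal.ofReal (r x))
    (ik : Integrable (fun ω => Real.log (k (X ω, V ω))) P)
    (ir : Integrable (fun ω => Real.log (r (W ω, V ω))) P) :
    condMutualInfo X V W P = ENNReal.ofReal
        ((∫ ω, Real.log (k (X ω, V ω)) ∂P - ∫ ω, Real.log (r (W ω, V ω)) ∂P) / Real.log 2) ∧
      0 ≤ ∫ ω, Real.log (k (X ω, V ω)) ∂P - ∫ ω, Real.log (r (W ω, V ω)) ∂P := by
  have hR := compProd_condDistrib_prod_eq hX hV hW P lam hr.ennreal_ofReal hlawr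
  set P' := P.map (fun ω => ((W ω, X ω), V ω)) with hP'
  have hm : Measurable fun ω => ((W ω, X ω), V ω) := by fun_prop
  have : IsProbabilityMeasure P' := Measure.isProbabilityMeasure_map hm.aemeasurable
  have : IsProbabilityMeasure (P.map W) := Measure.isProbabilityMeasure_map hW.aemeasurable
  set R' := ((P.map fun ω => (W ω, X ω)).prod lam).withDensity
    fun x => ENNReal.ofReal (r (x.1.1, x.2)) with hR'
  have : IsProbabilityMeasure R' := by
    have h : IsProbabilityMeasure (R'.map MeasurableEquiv.prodAssoc) := by
      rw [← hR]; infer_instance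
    exact ⟨by simpa [Measure.map_apply MeasurableEquiv.prodAssoc.measurable MeasurableSet.univ]
      using h.measure_univ⟩
  have hPP : P.map (fun ω => (W ω, X ω, V ω)) = P'.map MeasurableEquiv.prodAssoc := by
    rw [hP', Measure.map_map MeasurableEquiv.prodAssoc.measurable hm]
    rfl
  have hmk : Measurable fun x : (γ × α) × β => k (x.1.2, x.2) := by fun_prop
  have hmr : Measurable fun x : (γ × α) × β => r (x.1.1, x.2) := by fun_prop
  have hkl := klDiv_withDensity hmk hmr (fun x => hk0 _) (fun x => hr0 _) hlawk hR'
    ((integrable_map_measure hmk.log.aestronglyMeasurable hm.aemeasurable).2 ik)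
    ((integrable_map_measure hmr.log.aestronglyMeasurable hm.aemeasurable).2 ir)
  rw [hP', integral_map hm.aemeasurable hmk.log.aestronglyMeasurable,
    integral_map hm.aemeasurable hmr.log.aestronglyMeasurable] at hkl
  refine ⟨?_, hkl.2⟩
  rw [condMutualInfo, hPP, hR, klDiv_map_measurableEquiv, hkl.1,
    ENNReal.ofReal_div_of_pos (Real.log_pos one_lt_two)]

end KL

/-! ### Linear images of Gaussian vectors -/

section GaussianLaws

variable {ι κ ρ : Type*} [Fintype ι] [Fintype κ] [Fintype ρ]

open scoped RealInnerProductSpace in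
lemma inner_toLp_mulVec (A : Matrix ρ ι ℝ) (x : EuclideanSpace ℝ ι) (t : EuclideanSpace ℝ ρ) :
    ⟪WithLp.toLp 2 (A.mulVec x), t⟫ = ⟪x, WithLp.toLp 2 (A.transpose.mulVec t)⟫ := by
  simp only [EuclideanSpace.inner_eq_star_dotProduct, star_trivial]
  rw [Matrix.dotProduct_mulVec, Matrix.mulVec_transpose]

lemma dotProduct_mul_mul_transpose_mulVec (M : Matrix ρ ι ℝ) (N : Matrix ι ι ℝ) (t : ρ → ℝ) :
    t ⬝ᵥ (M * N * M.transpose).mulVec t =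
      (M.transpose.mulVec t) ⬝ᵥ N.mulVec (M.transpose.mulVec t) := by
  rw [← Matrix.mulVec_mulVec, ← Matrix.mulVec_mulVec, Matrix.dotProduct_mulVec,
    Matrix.mulVec_transpose]

variable [DecidableEq ι] [DecidableEq κ] [DecidableEq ρ]

/-- By independence the characteristic function of the image factors, and the exponents add up to
the quadratic form of the new covariance. Degenerate covariances are included. -/
lemma map_mulVec_add_mulVec_multivariateGaussian {S : Matrix ι ι ℝ} {T : Matrix κ κ ℝ}
    (hS : S.PosSemidef) (hT : T.PosSemidef) (A : Matrix ρ ι ℝ) (B : Matrix ρ κ ℝ) :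
    ((multivariateGaussian 0 S).prod (multivariateGaussian 0 T)).map
        (fun p => WithLp.toLp 2 (A.mulVec p.1 + B.mulVec p.2)) =
      multivariateGaussian 0 (A * S * A.transpose + B * T * B.transpose) := by
  have hA : (A * S * A.transpose).PosSemidef := by
    simpa using hS.mul_mul_conjTranspose_same A
  have hB : (B * T * B.transpose).PosSemidef := by
    simpa using hT.mul_mul_conjTranspose_same B
  have hm : Measurable fun p : EuclideanSpace ℝ ι × EuclideanSpace ℝ κ =>
      WithLp.toLp 2 (A.mulVec p.1 + B.mulVec p.2) := by
    refine Continuous.measurable ?_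
    fun_prop
  have : IsProbabilityMeasure (((multivariateGaussian 0 S).prod (multivariateGaussian 0 T)).map
      (fun p => WithLp.toLp 2 (A.mulVec p.1 + B.mulVec p.2))) :=
    Measure.isProbabilityMeasure_map hm.aemeasurable
  apply Measure.ext_of_charFun
  ext t
  rw [charFun_apply, integral_map hm.aemeasurable (by fun_prop),
    charFun_multivariateGaussian (hA.add hB)]
  have h : ∀ p : EuclideanSpace ℝ ι × EuclideanSpace ℝ κ,
      Complex.exp ((inner ℝ (WithLp.toLp 2 (A.mulVec p.1 + B.mulVec p.2)) t : ℝ) * Complex.I) =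
        Complex.exp ((inner ℝ p.1 (WithLp.toLp 2 (A.transpose.mulVec t)) : ℝ) * Complex.I) *
        Complex.exp ((inner ℝ p.2 (WithLp.toLp 2 (B.transpose.mulVec t)) : ℝ) * Complex.I) := by
    intro p
    rw [WithLp.toLp_add, inner_add_left, inner_toLp_mulVec, inner_toLp_mulVec, ← Complex.exp_add]
    push_cast
    rw [add_mul]
  simp_rw [h]
  rw [integral_prod_mul (fun x : EuclideanSpace ℝ ι =>
      Complex.exp ((inner ℝ x (WithLp.toLp 2 (A.transpose.mulVec t)) : ℝ) * Complex.I))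
    (fun x : EuclideanSpace ℝ κ =>
      Complex.exp ((inner ℝ x (WithLp.toLp 2 (B.transpose.mulVec t)) : ℝ) * Complex.I)),
    ← charFun_apply, ← charFun_apply, charFun_multivariateGaussian hS,
    charFun_multivariateGaussian hT, ← Complex.exp_add]
  congr 1
  rw [Matrix.add_mulVec, dotProduct_add, dotProduct_mul_mul_transpose_mulVec,
    dotProduct_mul_mul_transpose_mulVec]
  simp
  ring

lemma pi_gaussianReal_eq_piGaussian (q : ι → ℝ≥0) :
    (Measure.pi fun i => gaussianReal 0 (q i)) =
      piGaussian (Matrix.diagonal fun i => (q i : ℝ)) := by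
  have hd : (Matrix.diagonal fun i => (q i : ℝ)).PosSemidef :=
    Matrix.PosSemidef.diagonal fun i => (q i).2
  have h : (Measure.pi fun i => gaussianReal 0 (q i)).map (WithLp.toLp 2) =
      multivariateGaussian 0 (Matrix.diagonal fun i => (q i : ℝ)) := by
    have : IsProbabilityMeasure ((Measure.pi fun i => gaussianReal 0 (q i)).map
      (WithLp.toLp 2)) := Measure.isProbabilityMeasure_map (by fun_prop)
    apply Measure.ext_of_charFun (E := EuclideanSpace ℝ ι)
    ext t
    rw [charFun_pi, charFun_multivariateGaussian hd]
    simp_rw [charFun_gaussianReal, ← Complex.exp_sum]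
    congr 1
    simp [Matrix.mulVec_diagonal, dotProduct, Finset.sum_div]
    refine Finset.sum_congr rfl fun i _ => ?_
    ring
  rw [piGaussian, ← h, Measure.map_map (by fun_prop) (by fun_prop)]
  exact Measure.map_id.symm

lemma map_mulVec_add_mulVec_piGaussian {S : Matrix ι ι ℝ} {T : Matrix κ κ ℝ}
    (hS : S.PosSemidef) (hT : T.PosSemidef) (A : Matrix ρ ι ℝ) (B : Matrix ρ κ ℝ) :
    ((piGaussian S).prod (piGaussian T)).map (fun p => A.mulVec p.1 + B.mulVec p.2) =
      piGaussian (A * S * A.transpose + B * T * B.transpose) := by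
  have hm : Measurable fun p : (ι → ℝ) × (κ → ℝ) => A.mulVec p.1 + B.mulVec p.2 :=
    Continuous.measurable (by fun_prop)
  have hm' : Measurable fun p : EuclideanSpace ℝ ι × EuclideanSpace ℝ κ =>
      WithLp.toLp 2 (A.mulVec p.1 + B.mulVec p.2) := Continuous.measurable (by fun_prop)
  conv_rhs => rw [piGaussian, ← map_mulVec_add_mulVec_multivariateGaussian hS hT]
  rw [piGaussian, piGaussian, Measure.map_prod_map _ _ (by fun_prop) (by fun_prop),
    Measure.map_map hm (by fun_prop), Measure.map_map (by fun_prop) hm']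
  rfl

end GaussianLaws

/-! ### The Berger–Tung information quantities as determinants -/

section Reindex

/-- Used for subvectors of the test-channel noise, for the leaders, and for sub-blocks in time. -/
lemma map_pi_comp_injective {ι κ : Type*} [Fintype ι] [Fintype κ] {E : Type*} [MeasurableSpace E]
    (μ : κ → Measure E) [∀ k, IsProbabilityMeasure (μ k)] {e : ι → κ} (he : e.Injective) :
    (Measure.pi μ).map (fun x i => x (e i)) = Measure.pi fun i => μ (e i) := by
  have h := (iIndepFun_pi (μ := μ) (X := fun _ => id) fun _ => aemeasurable_id).precomp he
  simp only [id_eq] at h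
  rw [(iIndepFun_iff_map_fun_eq_pi_map fun i => (measurable_pi_apply (e i)).aemeasurable).1 h]
  congr 1
  ext1 i
  exact (measurePreserving_eval μ (e i)).map_eq

/-- Translation invariance of Lebesgue measure: given the first component, the sum has the noise
density shifted by `X`. -/
lemma map_prodMk_add_withDensity {α ι : Type*} [MeasurableSpace α] [Fintype ι]
    (m : Measure α) [SFinite m] {X : α → ι → ℝ} (hX : Measurable X) {f : (ι → ℝ) → ℝ≥0∞}
    (hf : Measurable f) :
    (m.prod ((volume : Measure (ι → ℝ)).withDensity f)).map (fun p => (p.1, X p.1 + p.2)) =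
      (m.prod volume).withDensity fun p => f (p.2 - X p.1) := by
  have hg : Measurable fun p : α × (ι → ℝ) => (p.1, X p.1 + p.2) := by fun_prop
  have hf' : Measurable fun p : α × (ι → ℝ) => f (p.2 - X p.1) := by fun_prop
  rw [prod_withDensity_right hf]
  refine Measure.ext_of_lintegral _ fun φ hφ => ?_
  have hf2 : Measurable fun p : α × (ι → ℝ) => f p.2 := by fun_prop
  have hφg : Measurable fun p : α × (ι → ℝ) => φ (p.1, X p.1 + p.2) := hφ.comp hg
  rw [lintegral_map hφ hg, lintegral_withDensity_eq_lintegral_mul _ hf2 hφg,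
    lintegral_withDensity_eq_lintegral_mul _ hf' hφ,
    lintegral_prod _ (hf2.mul hφg).aemeasurable,
    lintegral_prod _ (hf'.mul hφ).aemeasurable]
  refine lintegral_congr fun a => ?_
  rw [← lintegral_add_left_eq_self
    (fun x => ((fun p : α × (ι → ℝ) => f (p.2 - X p.1)) * φ) (a, x)) (X a)]
  simp

lemma map_withDensity_measurableEquiv {α β : Type*} [MeasurableSpace α] [MeasurableSpace β]
    (m : Measure α) (e : α ≃ᵐ β) {f : α → ℝ≥0∞} (hf : Measurable f) :
    (m.withDensity f).map e = (m.map e).withDensity fun x => f (e.symm x) := by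
  refine Measure.ext_of_lintegral _ fun φ hφ => ?_
  rw [lintegral_map hφ e.measurable, lintegral_withDensity_eq_lintegral_mul _ hf
      (by exact hφ.comp e.measurable), lintegral_withDensity_eq_lintegral_mul _
      (by exact hf.comp e.symm.measurable) hφ, lintegral_map
      (by exact (hf.comp e.symm.measurable).mul hφ) e.measurable]
  simp

end Reindex

section Information

variable {L : ℕ}

lemma map_auxU_comp {S : Matrix (Fin L) (Fin L) ℝ} (hS : S.PosSemidef) (q : Fin L → ℝ≥0)
    {ι : Type*} [Fintype ι] [DecidableEq ι] (e : ι → Fin L) :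
    (testLaw S q).map (fun ω i => auxU ω (e i)) =
      piGaussian ((S + Matrix.diagonal fun i => (q i : ℝ)).submatrix e e) := by
  have hd : (Matrix.diagonal fun i => (q i : ℝ)).PosSemidef :=
    Matrix.PosSemidef.diagonal fun i => (q i).2
  set A : Matrix ι (Fin L) ℝ := (1 : Matrix (Fin L) (Fin L) ℝ).submatrix e id with hA
  have h1 : ∀ M : Matrix (Fin L) (Fin L) ℝ, A * M * A.transpose = M.submatrix e e := by
    intro M
    ext i j
    simp [hA, Matrix.mul_apply, Matrix.one_apply]
  have h2 : ∀ x : Fin L → ℝ, A.mulVec x = fun i => x (e i) := by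
    intro x
    ext i
    simp [hA, Matrix.mulVec, dotProduct, Matrix.one_apply]
  have h := map_mulVec_add_mulVec_piGaussian hS hd A A
  rw [h1, h1, ← pi_gaussianReal_eq_piGaussian, ← Measure.map_id (μ := Measure.pi _), piGaussian,
    Measure.map_prod_map _ _ (by fun_prop) (by fun_prop),
    Measure.map_map (Continuous.measurable (by fun_prop)) (by fun_prop)] at h
  rw [Matrix.submatrix_add, Pi.add_apply, Pi.add_apply, ← h]
  congr 1
  ext ω i
  simp [h2, auxU]

/-- Half the logarithm (in nats) of a ratio of determinants. For `w i = 1 / q i` this is the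
information quantity `I(Y_A; U_A | U_{Aᶜ})`. -/
def infoNats (S : Matrix (Fin L) (Fin L) ℝ) (w : Fin L → ℝ) (A : Finset (Fin L)) : ℝ :=
  (Real.log (1 + S * Matrix.diagonal w).det -
    Real.log (1 + S * Matrix.diagonal fun i => if i ∈ A then 0 else w i).det) / 2

/-- Discarding a coordinate of `U` is the same as giving it weight zero. All subvectors are thus
described by determinants of full size, which differ only in their weights. -/
lemma log_det_submatrix_add_diagonal {S : Matrix (Fin L) (Fin L) ℝ} (hS : S.PosSemidef)
    {q : Fin L → ℝ} (hq : ∀ i, 0 < q i) {ι : Type*} [Fintype ι] [DecidableEq ι] {e : ι → Fin L}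
    (he : e.Injective) :
    Real.log ((S + Matrix.diagonal q).submatrix e e).det =
      Real.log (1 + S * Matrix.diagonal
        fun k => if k ∈ Set.range e then (q k)⁻¹ else 0).det + ∑ i, Real.log (q (e i)) := by
  classical
  have h1 : (S + Matrix.diagonal q).submatrix e e =
      S.submatrix e e + Matrix.diagonal fun i => q (e i) := by
    ext i j
    simp [Matrix.diagonal_apply, he.eq_iff]
  have h2 : (fun k => ∑ i, if e i = k then (q (e i))⁻¹ else 0) =
      fun k => if k ∈ Set.range e then (q k)⁻¹ else 0 := by
    ext k
    split_ifs with hk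
    · obtain ⟨i, rfl⟩ := hk
      simp [he.eq_iff]
    · refine Finset.sum_eq_zero fun i _ => if_neg fun h => hk ⟨i, h⟩
  rw [h1, det_add_diagonal _ fun i => (hq (e i)).ne', det_one_add_submatrix_mul_diagonal, h2,
    Real.log_mul, Real.log_prod fun i _ => (hq (e i)).ne']
  · refine (det_one_add_mul_diagonal_pos hS fun i => ?_).ne'
    split_ifs
    exacts [(inv_pos.2 (hq i)).le, le_rfl]
  · exact Finset.prod_ne_zero_iff.2 fun i _ => (hq (e i)).ne'

/-- The noise in the test channels of `A` is independent of the sources and of the noise in the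
other test channels. -/
lemma map_testLaw_split (S : Matrix (Fin L) (Fin L) ℝ) (q : Fin L → ℝ≥0) (A : Finset (Fin L)) :
    (testLaw S q).map (fun ω => ((ω.1, fun i : (Aᶜ : Finset (Fin L)) => ω.2 i),
        fun i : A => ω.2 i)) =
      ((multivariateGaussian 0 S).prod (Measure.pi fun i : (Aᶜ : Finset (Fin L)) =>
        gaussianReal 0 (q i))).prod (Measure.pi fun i : A => gaussianReal 0 (q i)) := by
  have hind := (iIndepFun_pi (μ := fun i => gaussianReal 0 (q i)) (X := fun _ => id)
    fun _ => aemeasurable_id).indepFun_finset Aᶜ A disjoint_compl_left fun i => by fun_prop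
  simp only [id_eq] at hind
  have hm : ∀ B : Finset (Fin L), Measurable fun (x : Fin L → ℝ) (i : B) => x i :=
    fun B => by fun_prop
  have h1 := (indepFun_iff_map_prod_eq_prod_map_map (hm _).aemeasurable
    (hm _).aemeasurable).1 hind
  rw [map_pi_comp_injective _ Subtype.val_injective,
    map_pi_comp_injective _ Subtype.val_injective] at h1
  rw [← (measurePreserving_prodAssoc _ _ _).symm.map_eq, ← h1,
    ← Measure.map_id (μ := multivariateGaussian 0 S),
    Measure.map_prod_map _ _ (by fun_prop) (by fun_prop),
    Measure.map_map (MeasurableEquiv.measurable _) (by fun_prop)]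
  rfl

/-- Given `Y_A` and `U_{Aᶜ}`, the vector `U_A` has the density of `Q_A` shifted by `Y_A`; given
`U_{Aᶜ}` alone, its density is that of `U` divided by that of `U_{Aᶜ}`. These densities exist even
for singular `S`, since `S + diagonal q` is positive definite. Nonnegativity is recorded because
`ENNReal.ofReal` would hide a negative value. -/
lemma condMutualInfo_testLaw {S : Matrix (Fin L) (Fin L) ℝ} (hS : S.PosSemidef)
    {q : Fin L → ℝ≥0} (hq : ∀ i, 0 < q i) (A : Finset (Fin L)) :
    condMutualInfo (subY A) (subU A) (subU Aᶜ) (testLaw S q) =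
        ENNReal.ofReal (infoNats S (fun i => (q i : ℝ)⁻¹) A / Real.log 2) ∧
      0 ≤ infoNats S (fun i => (q i : ℝ)⁻¹) A := by
  have hq' : ∀ i, (0 : ℝ) < q i := fun i => by exact_mod_cast hq i
  have hT : (S + Matrix.diagonal fun i => (q i : ℝ)).PosDef :=
    (Matrix.PosDef.diagonal hq').posSemidef_add hS
  set T := S + Matrix.diagonal fun i => (q i : ℝ) with hTdef
  -- `e` lists the coordinates outside `A` before those in `A`, so that `U` splits as `(U_{Aᶜ},
  -- U_A)`.
  set e : (Aᶜ : Finset (Fin L)) ⊕ A → Fin L := Sum.elim Subtype.val Subtype.val with he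
  have heinj : e.Injective := by
    refine Subtype.val_injective.sumElim Subtype.val_injective fun i j h => ?_
    exact Finset.mem_compl.1 i.2 (h ▸ j.2)
  set eW : (Aᶜ : Finset (Fin L)) → Fin L := Subtype.val with heW
  have heWinj : eW.Injective := Subtype.val_injective
  obtain ⟨pU, hpUm, hpU0, hpUlaw, hpUint, hpUval⟩ :=
    exists_density_piGaussian (hT.submatrix heinj)
  obtain ⟨pW, hpWm, hpW0, hpWlaw, hpWint, hpWval⟩ :=
    exists_density_piGaussian (hT.submatrix heWinj)
  obtain ⟨pQ, hpQm, hpQ0, hpQlaw, hpQint, hpQval⟩ :=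
    exists_density_piGaussian (Matrix.PosDef.diagonal fun i : A => hq' i)
  rw [← pi_gaussianReal_eq_piGaussian (fun i : A => q i)] at hpQlaw hpQint hpQval
  have hmY : Measurable (subY A) := by unfold subY; fun_prop
  have hmU : ∀ B : Finset (Fin L), Measurable (subU B) := by
    intro B; unfold subU auxU; fun_prop
  set eq := (MeasurableEquiv.sumPiEquivProdPi
    fun _ : (Aᶜ : Finset (Fin L)) ⊕ A => ℝ) with heq
  have hmUe : Measurable fun (ω : TestSpace L) i => auxU ω (e i) := by unfold auxU; fun_prop
  have hUe : ∀ ω : TestSpace L, eq.symm (subU Aᶜ ω, subU A ω) = fun i => auxU ω (e i) := by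
    intro ω
    rw [MeasurableEquiv.symm_apply_eq]
    rfl
  have hlawU : (testLaw S q).map (fun ω i => auxU ω (e i)) = _ :=
    (map_auxU_comp hS q e).trans hpUlaw
  have hlawW : (testLaw S q).map (subU Aᶜ) = _ := (map_auxU_comp hS q eW).trans hpWlaw
  have hmsplit : Measurable fun ω : TestSpace L =>
      ((ω.1, fun i : (Aᶜ : Finset (Fin L)) => ω.2 i), fun i : A => ω.2 i) := by fun_prop
  have hmQ : Measurable fun (ω : TestSpace L) (i : A) => ω.2 i := by fun_prop
  have hlawQ : (testLaw S q).map (fun (ω : TestSpace L) (i : A) => ω.2 i) =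
      Measure.pi fun i : A => gaussianReal 0 (q i) := by
    have h := congrArg (Measure.map Prod.snd) (map_testLaw_split S q A)
    rw [Measure.map_map measurable_snd hmsplit, Measure.map_snd_prod] at h
    simpa [Function.comp_def] using h
  have hvQ : ∀ ω : TestSpace L, subU A ω - subY A ω = fun i : A => ω.2 i := by
    intro ω; ext i; simp [subU, subY, auxU]
  set r : ((Aᶜ : Finset (Fin L)) → ℝ) × (A → ℝ) → ℝ := fun x => pU (eq.symm x) / pW x.1 with hr
  set k : (A → ℝ) × (A → ℝ) → ℝ := fun x => pQ (x.2 - x.1) with hk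
  have hlogr : ∀ ω, Real.log (r (subU Aᶜ ω, subU A ω)) =
      Real.log (pU fun i => auxU ω (e i)) - Real.log (pW (subU Aᶜ ω)) := by
    intro ω
    simp only [hr]
    rw [Real.log_div (hpU0 _).ne' (hpW0 _).ne', hUe]
  have hlogk : ∀ ω, Real.log (k (subY A ω, subU A ω)) = Real.log (pQ fun i : A => ω.2 i) := by
    intro ω
    simp only [hk]
    rw [hvQ]
  have iU : Integrable (fun ω => Real.log (pU fun i => auxU ω (e i))) (testLaw S q) := by
    rw [← map_auxU_comp hS q e] at hpUint
    exact hpUint.comp_measurable hmUe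
  have iW : Integrable (fun ω => Real.log (pW (subU Aᶜ ω))) (testLaw S q) := by
    rw [← map_auxU_comp hS q eW] at hpWint
    exact hpWint.comp_measurable (hmU _)
  have iQ : Integrable (fun ω : TestSpace L => Real.log (pQ fun i : A => ω.2 i))
      (testLaw S q) := by
    rw [← hlawQ] at hpQint
    exact hpQint.comp_measurable hmQ
  have vU : ∫ ω, Real.log (pU fun i => auxU ω (e i)) ∂(testLaw S q) =
      ∫ x, Real.log (pU x) ∂(piGaussian (T.submatrix e e)) := by
    rw [← map_auxU_comp hS q e, integral_map hmUe.aemeasurable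
      hpUm.log.aestronglyMeasurable]
  have vW : ∫ ω, Real.log (pW (subU Aᶜ ω)) ∂(testLaw S q) =
      ∫ x, Real.log (pW x) ∂(piGaussian (T.submatrix eW eW)) := by
    rw [← map_auxU_comp hS q eW]
    exact (integral_map (hmU _).aemeasurable hpWm.log.aestronglyMeasurable).symm
  have vQ : ∫ ω : TestSpace L, Real.log (pQ fun i : A => ω.2 i) ∂(testLaw S q) =
      ∫ x, Real.log (pQ x) ∂(Measure.pi fun i : A => gaussianReal 0 (q i)) := by
    rw [← hlawQ, integral_map hmQ.aemeasurable hpQm.log.aestronglyMeasurable]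
  have key := condMutualInfo_eq_of_density hmY (hmU A) (hmU Aᶜ) (testLaw S q) volume
    (k := k) (r := r) (hpQm.comp (by fun_prop))
    ((hpUm.comp eq.symm.measurable).div (hpWm.comp measurable_fst)) (fun x => hpQ0 _)
    (fun x => div_pos (hpU0 _) (hpW0 _)) ?_ ?_ (by simp_rw [hlogk]; exact iQ)
    (by simp_rw [hlogr]; exact iU.sub iW)
  · have hval : ∫ ω, Real.log (k (subY A ω, subU A ω)) ∂(testLaw S q) -
        ∫ ω, Real.log (r (subU Aᶜ ω, subU A ω)) ∂(testLaw S q) =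
        infoNats S (fun i => (q i : ℝ)⁻¹) A := by
      simp_rw [hlogk, hlogr]
      rw [integral_sub iU iW, vU, vW, vQ, hpUval, hpWval, hpQval, hTdef,
        log_det_submatrix_add_diagonal hS hq' heinj, log_det_submatrix_add_diagonal hS hq' heWinj,
        Matrix.det_diagonal, Real.log_prod fun (i : A) _ => (hq' i).ne', infoNats]
      have h1 : (fun k => if k ∈ Set.range e then (q k : ℝ)⁻¹ else 0) = fun k => (q k : ℝ)⁻¹ := by
        ext k
        rw [if_pos]
        by_cases hkA : k ∈ A
        · exact ⟨.inr ⟨k, hkA⟩, rfl⟩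
        · exact ⟨.inl ⟨k, Finset.mem_compl.2 hkA⟩, rfl⟩
      have h2 : (fun k => if k ∈ Set.range eW then (q k : ℝ)⁻¹ else 0) =
          fun k => if k ∈ A then 0 else (q k : ℝ)⁻¹ := by
        ext k
        simp only [heW, Subtype.range_coe_subtype, Set.mem_ofPred_eq, Finset.mem_compl]
        by_cases hkA : k ∈ A <;> simp [hkA]
      rw [h1, h2]
      -- The multiples of `stdLogPDFMean` cancel because the cardinalities of `Aᶜ` and `A` add up,
      -- and so do the terms `log (q i)`.
      simp only [Fintype.sum_sum_type, he, heW, Sum.elim_inl, Sum.elim_inr, Fintype.card_sum]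
      push_cast
      ring
    rwa [hval] at key
  · set m0 := (multivariateGaussian 0 S).prod (Measure.pi fun i : (Aᶜ : Finset (Fin L)) =>
      gaussianReal 0 (q i)) with hm0
    set G : EuclideanSpace ℝ (Fin L) × ((Aᶜ : Finset (Fin L)) → ℝ) →
        ((Aᶜ : Finset (Fin L)) → ℝ) × (A → ℝ) := fun p => (fun i => p.1 i + p.2 i, fun i => p.1 i)
      with hG
    have hmG : Measurable G := by fun_prop
    have hmWX : Measurable fun ω => (subU Aᶜ ω, subY A ω) := (hmU _).prodMk hmY
    have hjoint : (testLaw S q).map (fun ω => ((subU Aᶜ ω, subY A ω), fun i : A => ω.2 i)) =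
        (m0.map G).prod (Measure.pi fun i : A => gaussianReal 0 (q i)) := by
      have h := congrArg (Measure.map (Prod.map G id)) (map_testLaw_split S q A)
      rw [Measure.map_map (hmG.prodMap measurable_id) hmsplit,
        ← Measure.map_prod_map _ _ hmG measurable_id, Measure.map_id] at h
      exact h
    have hmarg : (testLaw S q).map (fun ω => (subU Aᶜ ω, subY A ω)) = m0.map G := by
      have h := congrArg (Measure.map Prod.fst) hjoint
      rw [Measure.map_map measurable_fst (hmWX.prodMk hmQ), Measure.map_fst_prod] at h
      simpa [Function.comp_def] using h
    have : IsProbabilityMeasure (m0.map G) := Measure.isProbabilityMeasure_map hmG.aemeasurable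
    rw [hmarg, ← map_prodMk_add_withDensity (m0.map G) measurable_snd hpQm.ennreal_ofReal,
      ← hpQlaw, ← hjoint, Measure.map_map (by fun_prop) (hmWX.prodMk hmQ)]
    rfl
  · have h1 : (testLaw S q).map (fun ω => (subU Aᶜ ω, subU A ω)) =
        ((testLaw S q).map (fun ω i => auxU ω (e i))).map eq := by
      rw [Measure.map_map eq.measurable hmUe]
      rfl
    have hrm : Measurable r := (hpUm.comp eq.symm.measurable).div (hpWm.comp measurable_fst)
    have hvol : (volume : Measure ((Aᶜ : Finset (Fin L)) ⊕ A → ℝ)).map eq =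
        volume.prod volume :=
      (volume_measurePreserving_sumPiEquivProdPi
        fun _ : (Aᶜ : Finset (Fin L)) ⊕ A => ℝ).map_eq
    rw [h1, hlawU, hlawW, map_withDensity_measurableEquiv _ _ hpUm.ennreal_ofReal, hvol,
      prod_withDensity_left hpWm.ennreal_ofReal, ← withDensity_mul _
        (by exact hpWm.ennreal_ofReal.comp measurable_fst) hrm.ennreal_ofReal]
    congr 1
    ext x
    simp only [Pi.mul_apply, hr]
    rw [← ENNReal.ofReal_mul (hpW0 _).le, mul_div_cancel₀ _ (hpW0 _).ne']

end Information

/-! ### Minimum mean squared error -/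

section MMSE

/-- The conditional expectation minimizes the mean squared error. -/
lemma integral_sq_sub_condExp_le {Ω : Type*} {m m0 : MeasurableSpace Ω} {μ : Measure Ω}
    [IsProbabilityMeasure μ] (hm : m ≤ m0) {X Z : Ω → ℝ} (hX : MemLp X 2 μ) (hZ : MemLp Z 2 μ)
    (hZm : StronglyMeasurable[m] Z) :
    ∫ ω, (X ω - (μ[X | m]) ω) ^ 2 ∂μ ≤ ∫ ω, (X ω - Z ω) ^ 2 ∂μ := by
  set E := μ[X | m] with hE
  have hEL : MemLp E 2 μ := hX.condExp (by norm_num)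
  have hW : MemLp (E - Z) 2 μ := hEL.sub hZ
  have hWm : StronglyMeasurable[m] (E - Z) := stronglyMeasurable_condExp.sub hZm
  have h1 : ∫ ω, (X * (E - Z)) ω ∂μ = ∫ ω, (E * (E - Z)) ω ∂μ := by
    rw [← integral_condExp hm]
    exact integral_congr_ae (condExp_mul_of_stronglyMeasurable_right hWm (hX.integrable_mul hW)
      (hX.integrable (by norm_num)))
  have h2 : ∫ ω, (X ω - E ω) * (E ω - Z ω) ∂μ = 0 := by
    have : (fun ω => (X ω - E ω) * (E ω - Z ω)) = X * (E - Z) - E * (E - Z) := by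
      ext ω; simp; ring
    rw [this, integral_sub' (hX.integrable_mul hW) (hEL.integrable_mul hW), h1, sub_self]
  have h3 : ∀ ω, (X ω - Z ω) ^ 2 =
      (X ω - E ω) ^ 2 + (2 * ((X ω - E ω) * (E ω - Z ω)) + (E ω - Z ω) ^ 2) := fun ω => by ring
  have i1 : Integrable (fun ω => (X ω - E ω) ^ 2) μ := (hX.sub hEL).integrable_sq
  have i2 : Integrable (fun ω => (X ω - E ω) * (E ω - Z ω)) μ := (hX.sub hEL).integrable_mul hW
  have i3 : Integrable (fun ω => (E ω - Z ω) ^ 2) μ := hW.integrable_sq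
  simp_rw [h3]
  rw [integral_add i1 (by exact (i2.const_mul 2).add i3), integral_add (i2.const_mul 2) i3,
    integral_const_mul, h2]
  have : 0 ≤ ∫ ω, (E ω - Z ω) ^ 2 ∂μ := integral_nonneg fun ω => sq_nonneg _
  linarith

lemma memLp_two_of_lintegral_sq {Ω : Type*} [MeasurableSpace Ω] {μ : Measure Ω} {f : Ω → ℝ}
    (hf : AEStronglyMeasurable f μ) (h : ∫⁻ ω, ENNReal.ofReal (f ω ^ 2) ∂μ ≠ ∞) : MemLp f 2 μ := by
  rw [memLp_two_iff_integrable_sq hf]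
  exact ⟨hf.pow 2, (hasFiniteIntegral_iff_ofReal (ae_of_all _ fun ω => sq_nonneg _)).2 h.lt_top⟩

lemma memLp_source {L : ℕ} (S : Matrix (Fin L) (Fin L) ℝ) (i : Fin L) :
    MemLp (fun y : EuclideanSpace ℝ (Fin L) => y i) 2 (multivariateGaussian 0 S) := by
  have h := IsGaussian.memLp_dual (multivariateGaussian 0 S) (EuclideanSpace.proj (𝕜 := ℝ) i)
    2 (by simp)
  exact h

/-- Since the conditional expectation is the best estimator, any estimator from `U` that meets the
bound will do, and no conditional expectation has to be computed when channels are changed. The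
lower integral spares integrability conditions. The clause `0 ≤ D i` is needed because
`ENNReal.ofReal` sends negative numbers to zero. -/
lemma isAdmissible_iff {L : ℕ} {S : Matrix (Fin L) (Fin L) ℝ} {D : Fin L → ℝ}
    {q : Fin L → ℝ≥0} :
    IsAdmissible S D q ↔ (∀ i, 0 < q i) ∧ ∀ i, 0 ≤ D i ∧ ∃ h : (Fin L → ℝ) → ℝ, Measurable h ∧
      ∫⁻ ω, ENNReal.ofReal ((ω.1 i - h (auxU ω)) ^ 2) ∂(testLaw S q) ≤ ENNReal.ofReal (D i) := by
  have hmU : Measurable (auxU (L := L)) := by unfold auxU; fun_prop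
  have hle : MeasurableSpace.comap auxU inferInstance ≤
      (inferInstance : MeasurableSpace (TestSpace L)) := hmU.comap_le
  have hX : ∀ i, MemLp (fun ω : TestSpace L => ω.1 i) 2 (testLaw S q) := fun i =>
    (memLp_source S i).comp_fst _
  refine and_congr_right fun _ => forall_congr' fun i => ?_
  have hE := (hX i).condExp (m := MeasurableSpace.comap auxU inferInstance) (by norm_num)
  constructor
  · intro hi
    obtain ⟨h, hh, heq⟩ := (stronglyMeasurable_condExp (f := fun ω : TestSpace L => ω.1 i)
      (μ := testLaw S q) (m := MeasurableSpace.comap auxU inferInstance)).measurable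
        |>.exists_eq_measurable_comp
    refine ⟨(integral_nonneg fun ω => sq_nonneg _).trans hi, h, hh, ?_⟩
    have h1 : ∀ ω, ENNReal.ofReal ((ω.1 i - h (auxU ω)) ^ 2) =
        ENNReal.ofReal ((ω.1 i - ((testLaw S q)[fun ω' : TestSpace L => ω'.1 i |
          MeasurableSpace.comap auxU inferInstance]) ω) ^ 2) := fun ω => by
      rw [heq]; rfl
    simp_rw [h1]
    rw [← ofReal_integral_eq_lintegral_ofReal (by exact ((hX i).sub hE).integrable_sq)
      (ae_of_all _ fun ω => sq_nonneg _)]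
    exact ENNReal.ofReal_le_ofReal hi
  · rintro ⟨hD, h, hh, hle'⟩
    have hmd : Measurable fun ω : TestSpace L => ω.1 i - h (auxU ω) := by
      have := hh.comp hmU
      fun_prop
    have hd : MemLp (fun ω : TestSpace L => ω.1 i - h (auxU ω)) 2 (testLaw S q) :=
      memLp_two_of_lintegral_sq hmd.aestronglyMeasurable (hle'.trans_lt ENNReal.ofReal_lt_top).ne
    have hZ : MemLp (fun ω : TestSpace L => h (auxU ω)) 2 (testLaw S q) := by
      refine ((hX i).sub hd).congr_norm (hh.comp hmU).aestronglyMeasurable (ae_of_all _ fun ω => ?_)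
      simp
    refine (integral_sq_sub_condExp_le hle (hX i) hZ
      (hh.comp (comap_measurable auxU)).stronglyMeasurable).trans ?_
    rw [← ENNReal.ofReal_le_ofReal_iff hD, ofReal_integral_eq_lintegral_ofReal hd.integrable_sq
      (ae_of_all _ fun ω => sq_nonneg _)]
    exact hle'

lemma lintegral_sq_const_add {Ω : Type*} [MeasurableSpace Ω] {ν : Measure Ω}
    [IsProbabilityMeasure ν] {b : Ω → ℝ} (hb : MemLp b 2 ν) (hb0 : ∫ x, b x ∂ν = 0) (c : ℝ) :
    ∫⁻ x, ENNReal.ofReal ((c + b x) ^ 2) ∂ν =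
      ENNReal.ofReal (c ^ 2) + ENNReal.ofReal (∫ x, b x ^ 2 ∂ν) := by
  have i1 : Integrable b ν := hb.integrable (by norm_num)
  have h : ∫ x, (c + b x) ^ 2 ∂ν = c ^ 2 + ∫ x, b x ^ 2 ∂ν := by
    have : ∀ x, (c + b x) ^ 2 = c ^ 2 + (2 * c * b x + b x ^ 2) := fun x => by ring
    simp_rw [this]
    rw [integral_add (integrable_const _) (by exact (i1.const_mul _).add hb.integrable_sq),
      integral_add (i1.const_mul _) hb.integrable_sq, integral_const_mul, hb0]
    simp
  rw [← ofReal_integral_eq_lintegral_ofReal (by exact ((memLp_const c).add hb).integrable_sq)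
    (ae_of_all _ fun ω => sq_nonneg _)]
  rw [h, ENNReal.ofReal_add (sq_nonneg _) (integral_nonneg fun x => sq_nonneg _)]

end MMSE

/-! ### Test channels of a block-degraded pair and of its induced pair -/

/-- The law of the noises that are added to the leaders. -/
def noiseLaw {L : ℕ} (z : Fin L → ℝ) : Measure (Fin L → ℝ) :=
  Measure.pi fun j => gaussianReal 0 (z j).toNNReal

instance {L : ℕ} (z : Fin L → ℝ) : IsProbabilityMeasure (noiseLaw z) := by
  unfold noiseLaw; infer_instance

lemma integral_eval_noiseLaw {L : ℕ} (z : Fin L → ℝ) (j : Fin L) :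
    ∫ n, n j ∂(noiseLaw z) = 0 := by
  rw [noiseLaw, integral_comp_eval (μ := fun j => gaussianReal 0 (z j).toNNReal) (i := j)
    (f := fun x => x) measurable_id.aestronglyMeasurable]
  simp

lemma memLp_eval_noiseLaw {L : ℕ} (z : Fin L → ℝ) (j : Fin L) :
    MemLp (fun n : Fin L → ℝ => n j) 2 (noiseLaw z) :=
  (memLp_id_gaussianReal' 2 (by simp)).comp_measurePreserving
    (measurePreserving_eval (fun j => gaussianReal 0 (z j).toNNReal) j)

lemma integral_sq_eval_noiseLaw {L : ℕ} {z : Fin L → ℝ} {j : Fin L} (hz : 0 ≤ z j) :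
    ∫ n, n j ^ 2 ∂(noiseLaw z) = z j := by
  rw [noiseLaw, integral_comp_eval (μ := fun j => gaussianReal 0 (z j).toNNReal) (i := j)
    (f := fun x => x ^ 2) (by fun_prop)]
  have h := variance_fun_id_gaussianReal (μ := 0) (v := (z j).toNNReal)
  rw [variance_of_integral_eq_zero (by fun_prop) (by simp)] at h
  rw [h, Real.coe_toNNReal _ hz]

lemma ae_eval_noiseLaw_eq_zero {L : ℕ} {z : Fin L → ℝ} {j : Fin L} (hz : z j = 0) :
    ∀ᵐ n ∂(noiseLaw z), n j = 0 := by
  have h : ∀ᵐ x ∂(gaussianReal 0 (z j).toNNReal), x = 0 := by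
    simp [hz]
  exact (measurePreserving_eval (fun j => gaussianReal 0 (z j).toNNReal)
    j).quasiMeasurePreserving.ae h

namespace IsBlockDegraded

variable {L K : ℕ} {S : Matrix (Fin L) (Fin L) ℝ} {D : Fin L → ℝ}
  {S' : Matrix (Fin K) (Fin K) ℝ} {D' : Fin K → ℝ}
  {g : Fin L → Fin K} {lead : Fin K → Fin L} {z : Fin L → ℝ}

lemma groupMatrix_mul_mul_transpose (g : Fin L → Fin K) (M : Matrix (Fin K) (Fin K) ℝ) :
    groupMatrix g * M * (groupMatrix g).transpose = M.submatrix g g := by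
  ext i j
  simp [groupMatrix, Matrix.mul_apply]

lemma groupMatrix_mulVec (g : Fin L → Fin K) (x : Fin K → ℝ) :
    (groupMatrix g).mulVec x = fun j => x (g j) := by
  ext i
  simp [groupMatrix, Matrix.mulVec, dotProduct]

lemma cov_eq' (h : IsBlockDegraded S D S' D' g lead z) :
    S = S'.submatrix g g + Matrix.diagonal z := by
  rw [h.cov_eq, groupMatrix_mul_mul_transpose]

lemma noise_nonneg (h : IsBlockDegraded S D S' D' g lead z) (j : Fin L) : 0 ≤ z j := by
  by_cases hj : j = lead (g j)
  · rw [hj, h.noise_lead]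
  · exact (h.noise_pos j hj).le

lemma lead_injective (h : IsBlockDegraded S D S' D' g lead z) : lead.Injective :=
  fun k l hkl => by rw [← h.lead_mem k, hkl, h.lead_mem]

lemma submatrix_lead (h : IsBlockDegraded S D S' D' g lead z) : S.submatrix lead lead = S' := by
  ext k l
  rw [h.cov_eq']
  by_cases hkl : k = l
  · subst hkl
    simp [h.lead_mem, h.noise_lead]
  · simp [h.lead_mem, h.lead_injective.eq_iff, hkl]

lemma posSemidef' (h : IsBlockDegraded S D S' D' g lead z) (hS : S.PosSemidef) :
    S'.PosSemidef := by
  rw [← h.submatrix_lead]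
  exact hS.submatrix lead

lemma dist_ge' (h : IsBlockDegraded S D S' D' g lead z) (j : Fin L) :
    D' (g j) + z j ≤ D j := by
  by_cases hj : j = lead (g j)
  · have h1 := h.dist_lead (g j)
    rw [← hj] at h1
    have h2 := h.noise_lead (g j)
    rw [← hj] at h2
    rw [h1, h2, add_zero]
  · exact h.dist_ge j hj

/-- Each source is the leader of its group plus independent noise. -/
lemma multivariateGaussian_eq_map (h : IsBlockDegraded S D S' D' g lead z) (hS : S.PosSemidef) :
    multivariateGaussian 0 S = ((multivariateGaussian 0 S').prod (noiseLaw z)).map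
      (fun p => WithLp.toLp 2 fun j => p.1 (g j) + p.2 j) := by
  have hd : (Matrix.diagonal z).PosSemidef := Matrix.PosSemidef.diagonal h.noise_nonneg
  have h1 := map_mulVec_add_mulVec_multivariateGaussian (h.posSemidef' hS) hd (groupMatrix g) 1
  rw [Matrix.one_mul, Matrix.transpose_one, Matrix.mul_one, ← h.cov_eq] at h1
  have h2 : noiseLaw z = (multivariateGaussian 0 (Matrix.diagonal z)).map
      (WithLp.ofLp (p := 2)) := by
    rw [noiseLaw, pi_gaussianReal_eq_piGaussian]
    simp [Real.coe_toNNReal _ (h.noise_nonneg _), piGaussian]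
  rw [h2, ← Measure.map_id (μ := multivariateGaussian 0 S'),
    Measure.map_prod_map _ _ (by fun_prop) (by fun_prop),
    Measure.map_map (Continuous.measurable (by fun_prop)) (by fun_prop), ← h1]
  congr 1
  ext p j
  simp [groupMatrix_mulVec]

/-- The source noise is integrated innermost, so that it can be averaged with the leaders and the
channel noise held fixed. -/
lemma lintegral_testLaw (h : IsBlockDegraded S D S' D' g lead z) (hS : S.PosSemidef)
    (q : Fin L → ℝ≥0) {F : TestSpace L → ℝ≥0∞} (hF : Measurable F) :
    ∫⁻ ω, F ω ∂(testLaw S q) = ∫⁻ y, ∫⁻ r, ∫⁻ n, F (WithLp.toLp 2 fun j => y (g j) + n j, r)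
      ∂(noiseLaw z) ∂(Measure.pi fun i => gaussianReal 0 (q i)) ∂(multivariateGaussian 0 S') := by
  have hm : Measurable fun p : EuclideanSpace ℝ (Fin K) × (Fin L → ℝ) =>
      (WithLp.toLp 2 fun j => p.1 (g j) + p.2 j : EuclideanSpace ℝ (Fin L)) := by fun_prop
  have hF1 : Measurable fun y => ∫⁻ r, F (y, r) ∂(Measure.pi fun i => gaussianReal 0 (q i)) :=
    hF.lintegral_prod_right'
  rw [testLaw, lintegral_prod _ hF.aemeasurable, h.multivariateGaussian_eq_map hS,
    lintegral_map hF1 hm, lintegral_prod _ (by exact (hF1.comp hm).aemeasurable)]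
  refine lintegral_congr fun y => ?_
  rw [lintegral_lintegral_swap]
  exact (hF.comp (by fun_prop : Measurable fun p : (Fin L → ℝ) × (Fin L → ℝ) =>
    ((WithLp.toLp 2 fun j => y (g j) + p.1 j : EuclideanSpace ℝ (Fin L)), p.2))).aemeasurable

/-- Admissible test channels for the leaders can be completed by arbitrary test channels. -/
lemma isAdmissible_of_lead (h : IsBlockDegraded S D S' D' g lead z) (hS : S.PosSemidef)
    {q' : Fin K → ℝ≥0} (hq' : IsAdmissible S' D' q') {q : Fin L → ℝ≥0} (hq : ∀ j, 0 < q j)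
    (hlead : ∀ k, q (lead k) = q' k) : IsAdmissible S D q := by
  rw [isAdmissible_iff] at hq' ⊢
  refine ⟨hq, fun j => ?_⟩
  obtain ⟨hD, f, hf, hle⟩ := hq'.2 (g j)
  -- Source `j` is estimated by the estimate of its leader, which reads only the leaders' channels.
  -- Its noise is centred and independent of that estimate, so the error grows by exactly `z j`.
  refine ⟨(add_nonneg hD (h.noise_nonneg j)).trans (h.dist_ge' j), fun u => f fun k => u (lead k),
    by fun_prop, ?_⟩
  rw [h.lintegral_testLaw hS q (by unfold auxU; fun_prop)]
  have hz : ∀ᵐ n ∂(noiseLaw z), ∀ k, n (lead k) = 0 :=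
    ae_all_iff.2 fun k => ae_eval_noiseLaw_eq_zero (h.noise_lead k)
  have hin : ∀ (y : EuclideanSpace ℝ (Fin K)) (r : Fin L → ℝ),
      ∫⁻ n, ENNReal.ofReal
        ((y (g j) + n j - f fun k => y (g (lead k)) + n (lead k) + r (lead k)) ^ 2) ∂(noiseLaw z) =
      ENNReal.ofReal ((y (g j) - f fun k => y k + r (lead k)) ^ 2) + ENNReal.ofReal (z j) := by
    intro y r
    rw [← integral_sq_eval_noiseLaw (h.noise_nonneg j),
      ← lintegral_sq_const_add (memLp_eval_noiseLaw z j) (integral_eval_noiseLaw z j)]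
    refine lintegral_congr_ae ?_
    filter_upwards [hz] with n hn
    simp only [hn, h.lead_mem, add_zero]
    congr 2
    ring
  have hG : Measurable fun p : EuclideanSpace ℝ (Fin K) × (Fin K → ℝ) =>
      ENNReal.ofReal ((p.1 (g j) - f fun k => p.1 k + p.2 k) ^ 2) := by fun_prop
  calc _ = ∫⁻ y, ∫⁻ r, (ENNReal.ofReal ((y (g j) - f fun k => y k + r (lead k)) ^ 2) +
          ENNReal.ofReal (z j)) ∂(Measure.pi fun i => gaussianReal 0 (q i))
          ∂(multivariateGaussian 0 S') := lintegral_congr fun y => lintegral_congr fun r => hin y r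
    _ = ∫⁻ y, ((∫⁻ r, ENNReal.ofReal ((y (g j) - f fun k => y k + r k) ^ 2)
          ∂(Measure.pi fun k => gaussianReal 0 (q' k))) + ENNReal.ofReal (z j))
          ∂(multivariateGaussian 0 S') := by
        refine lintegral_congr fun y => ?_
        rw [lintegral_add_right _ measurable_const, lintegral_const, measure_univ, mul_one]
        congr 1
        have := map_pi_comp_injective (fun i => gaussianReal 0 (q i)) h.lead_injective
        simp only [hlead] at this
        rw [← this, lintegral_map (by fun_prop) (by fun_prop)]
    _ = (∫⁻ ω, ENNReal.ofReal ((ω.1 (g j) - f (auxU ω)) ^ 2) ∂(testLaw S' q')) +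
          ENNReal.ofReal (z j) := by
        rw [lintegral_add_right _ measurable_const, lintegral_const, measure_univ, mul_one,
          testLaw, lintegral_prod _ (by exact hG.aemeasurable)]
        rfl
    _ ≤ ENNReal.ofReal (D' (g j)) + ENNReal.ofReal (z j) := by gcongr
    _ = ENNReal.ofReal (D' (g j) + z j) := (ENNReal.ofReal_add hD (h.noise_nonneg j)).symm
    _ ≤ ENNReal.ofReal (D j) := ENNReal.ofReal_le_ofReal (h.dist_ge' j)

/-- The noise variance of the test channel of the leader of group `k` that is equivalent to all
the test channels `q j` of the group taken together. -/
def mergedVar (g : Fin L → Fin K) (z : Fin L → ℝ) (q : Fin L → ℝ≥0) (k : Fin K) : ℝ≥0 :=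
  (∑ j, if g j = k then (q j + (z j).toNNReal)⁻¹ else 0)⁻¹

lemma mergedVar_pos (h : IsBlockDegraded S D S' D' g lead z) {q : Fin L → ℝ≥0}
    (hq : ∀ j, 0 < q j) (k : Fin K) : 0 < mergedVar g z q k := by
  rw [mergedVar, inv_pos]
  refine Finset.sum_pos' (fun j _ => by positivity) ⟨lead k, Finset.mem_univ _, ?_⟩
  rw [if_pos (h.lead_mem k)]
  have := hq (lead k)
  positivity

lemma inv_mergedVar (h : IsBlockDegraded S D S' D' g lead z) (q : Fin L → ℝ≥0) (k : Fin K) :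
    ((mergedVar g z q k : ℝ≥0) : ℝ)⁻¹ = ∑ j, if g j = k then ((q j : ℝ) + z j)⁻¹ else 0 := by
  rw [mergedVar]
  push_cast
  rw [inv_inv]
  refine Finset.sum_congr rfl fun j _ => ?_
  split_ifs <;> simp [Real.coe_toNNReal _ (h.noise_nonneg j)]

/-- The part of the noises in a group that is not contained in the merged noise has a positive
semidefinite covariance matrix. -/
lemma posSemidef_residual (h : IsBlockDegraded S D S' D' g lead z) {q : Fin L → ℝ≥0}
    (hq : ∀ j, 0 < q j) :
    ((Matrix.diagonal fun j => (q j : ℝ) + z j) -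
      (Matrix.diagonal fun k => (mergedVar g z q k : ℝ)).submatrix g g).PosSemidef := by
  set v : Fin L → ℝ := fun j => (q j : ℝ) + z j with hv
  have hv0 : ∀ j, 0 < v j := fun j =>
    add_pos_of_pos_of_nonneg (by exact_mod_cast hq j) (h.noise_nonneg j)
  set m : Fin K → ℝ := fun k => (mergedVar g z q k : ℝ) with hm
  have hm0 : ∀ k, 0 < m k := fun k => by exact_mod_cast h.mergedVar_pos hq k
  refine Matrix.PosSemidef.of_dotProduct_mulVec_nonneg ?_ fun x => ?_
  · refine Matrix.IsHermitian.sub (Matrix.isHermitian_diagonal _) ?_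
    exact (Matrix.isHermitian_diagonal m).submatrix g
  have h1 : x ⬝ᵥ ((Matrix.diagonal m).submatrix g g).mulVec x =
      ∑ k, m k * (∑ j with g j = k, x j) ^ 2 := by
    have hG : ∀ k, (groupMatrix g).transpose.mulVec x k = ∑ j with g j = k, x j := fun k => by
      simp [groupMatrix, Matrix.mulVec, dotProduct, Finset.sum_filter]
    rw [← groupMatrix_mul_mul_transpose, dotProduct_mul_mul_transpose_mulVec]
    simp only [dotProduct, Matrix.mulVec_diagonal, hG]
    exact Finset.sum_congr rfl fun k _ => by ring
  have h2 : x ⬝ᵥ (Matrix.diagonal v).mulVec x = ∑ k, ∑ j with g j = k, v j * x j ^ 2 := by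
    rw [Finset.sum_fiberwise]
    simp only [dotProduct, Matrix.mulVec_diagonal]
    exact Finset.sum_congr rfl fun j _ => by ring
  rw [star_trivial, Matrix.sub_mulVec, dotProduct_sub, h1, h2, sub_nonneg]
  refine Finset.sum_le_sum fun k _ => ?_
  -- Cauchy–Schwarz in the form `(∑ x j)² / ∑ (v j)⁻¹ ≤ ∑ v j * (x j)²`. The merged variance is `1 /
  -- ∑ (v j)⁻¹`, so this is the required inequality on group `k`.
  have h3 := Finset.sq_sum_div_le_sum_sq_div (Finset.univ.filter fun j => g j = k) x
    (g := fun j => (v j)⁻¹) fun j _ => inv_pos.2 (hv0 j)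
  have h4 : ∑ j with g j = k, (v j)⁻¹ = (m k)⁻¹ := by
    rw [hm, h.inv_mergedVar, Finset.sum_filter]
  rw [h4, div_inv_eq_mul, mul_comm] at h3
  refine h3.trans (le_of_eq (Finset.sum_congr rfl fun j _ => ?_))
  rw [div_inv_eq_mul, mul_comm]

/-- The total noise `Z + Q` has the law of a common noise per group, of the merged variance, plus an
independent residual: both are centred Gaussian with covariance `diagonal (q + z)`. -/
lemma lintegral_add_noise (h : IsBlockDegraded S D S' D' g lead z) {q : Fin L → ℝ≥0}
    (hq : ∀ j, 0 < q j) {f : (Fin L → ℝ) → ℝ≥0∞} (hf : Measurable f) :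
    ∫⁻ r, ∫⁻ n, f (fun j => n j + r j) ∂(noiseLaw z) ∂(Measure.pi fun i => gaussianReal 0 (q i)) =
      ∫⁻ r, ∫⁻ w, f (fun j => r (g j) + w j) ∂(piGaussian
        ((Matrix.diagonal fun j => (q j : ℝ) + z j) -
          (Matrix.diagonal fun k => (mergedVar g z q k : ℝ)).submatrix g g))
        ∂(Measure.pi fun k => gaussianReal 0 (mergedVar g z q k)) := by
  have hdq : (Matrix.diagonal fun j => (q j : ℝ)).PosSemidef :=
    Matrix.PosSemidef.diagonal fun j => (q j).2
  have hdz : (Matrix.diagonal z).PosSemidef := Matrix.PosSemidef.diagonal h.noise_nonneg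
  have hdm : (Matrix.diagonal fun k => (mergedVar g z q k : ℝ)).PosSemidef :=
    Matrix.PosSemidef.diagonal fun k => (mergedVar g z q k).2
  have h1 := map_mulVec_add_mulVec_piGaussian hdq hdz (1 : Matrix (Fin L) (Fin L) ℝ) 1
  have h2 := map_mulVec_add_mulVec_piGaussian hdm (h.posSemidef_residual hq) (groupMatrix g) 1
  rw [groupMatrix_mul_mul_transpose] at h2
  simp only [Matrix.one_mul, Matrix.transpose_one, Matrix.mul_one, Matrix.one_mulVec,
    add_sub_cancel, groupMatrix_mulVec, Matrix.diagonal_add] at h1 h2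
  have hnoise : noiseLaw z = piGaussian (Matrix.diagonal z) := by
    rw [noiseLaw, pi_gaussianReal_eq_piGaussian]
    simp [Real.coe_toNNReal _ (h.noise_nonneg _)]
  have e1 := congrArg (fun μ => ∫⁻ x, f x ∂μ) (h1.trans h2.symm)
  rw [lintegral_map hf (by fun_prop), lintegral_map hf (by fun_prop),
    lintegral_prod _ (by exact (hf.comp (by fun_prop)).aemeasurable),
    lintegral_prod _ (by exact (hf.comp (by fun_prop)).aemeasurable)] at e1
  rw [hnoise, pi_gaussianReal_eq_piGaussian, pi_gaussianReal_eq_piGaussian]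
  refine Eq.trans ?_ e1
  refine lintegral_congr fun r => lintegral_congr fun n => ?_
  congr 1
  ext j
  simp [add_comm]

/-- Merging the test channels of each group keeps them admissible. -/
lemma isAdmissible_mergedVar (h : IsBlockDegraded S D S' D' g lead z) (hS : S.PosSemidef)
    {q : Fin L → ℝ≥0} (hq : IsAdmissible S D q) : IsAdmissible S' D' (mergedVar g z q) := by
  rw [isAdmissible_iff] at hq ⊢
  refine ⟨h.mergedVar_pos hq.1, fun k => ?_⟩
  obtain ⟨hD, f, hf, hle⟩ := hq.2 (lead k)
  rw [h.dist_lead] at hD hle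
  refine ⟨hD, ?_⟩
  rw [h.lintegral_testLaw hS q (by unfold auxU; fun_prop)] at hle
  set C := (Matrix.diagonal fun j => (q j : ℝ) + z j) -
    (Matrix.diagonal fun k => (mergedVar g z q k : ℝ)).submatrix g g with hC
  have hz : ∀ᵐ n ∂(noiseLaw z), n (lead k) = 0 := ae_eval_noiseLaw_eq_zero (h.noise_lead k)
  have hG : Measurable fun p : TestSpace K × (Fin L → ℝ) =>
      ENNReal.ofReal ((p.1.1 k - f fun j => auxU p.1 (g j) + p.2 j) ^ 2) := by
    unfold auxU; fun_prop
  -- With the residual `w` frozen, `f` becomes an estimator from the merged observations. Averaged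
  -- over `w`, its error is that of `f` in the original problem, because the noise of the leader
  -- itself is almost surely zero.
  have key : ∫⁻ w, ∫⁻ ω, ENNReal.ofReal ((ω.1 k - f fun j => auxU ω (g j) + w j) ^ 2)
      ∂(testLaw S' (mergedVar g z q)) ∂(piGaussian C) ≤ ENNReal.ofReal (D' k) := by
    refine le_trans (le_of_eq ?_) hle
    rw [lintegral_lintegral_swap (by exact (hG.comp measurable_swap).aemeasurable), testLaw,
      lintegral_prod _ (by exact hG.lintegral_prod_right'.aemeasurable)]
    refine lintegral_congr fun y => ?_
    have := h.lintegral_add_noise hq.1 (f := fun x =>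
      ENNReal.ofReal ((y k - f fun j => y (g j) + x j) ^ 2)) (by fun_prop)
    refine Eq.trans ?_ (this.symm.trans ?_)
    · simp only [auxU, add_assoc]
      rfl
    · refine lintegral_congr fun r => lintegral_congr_ae ?_
      filter_upwards [hz] with n hn
      have hU : auxU ((WithLp.toLp 2 fun j => y (g j) + n j : EuclideanSpace ℝ (Fin L)), r) =
          fun j => y (g j) + (n j + r j) := by
        ext j
        simp [auxU, add_assoc]
      simp only [hU, hn, h.lead_mem, add_zero]
  -- Some `w` does no worse than the average. It may depend on `k`, since each distortion has its
  -- own estimator.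
  obtain ⟨w, hw⟩ := exists_le_lintegral (μ := piGaussian C)
    (f := fun w => ∫⁻ ω, ENNReal.ofReal ((ω.1 k - f fun j => auxU ω (g j) + w j) ^ 2)
      ∂(testLaw S' (mergedVar g z q)))
    (by exact (hG.comp measurable_swap).lintegral_prod_right'.aemeasurable)
  exact ⟨fun u => f fun j => u (g j) + w j, by fun_prop, hw.trans key⟩

end IsBlockDegraded

/-! ### Equality of the Berger–Tung sum-rates -/

lemma mem_btRegion_iff {L : ℕ} {S : Matrix (Fin L) (Fin L) ℝ} (hS : S.PosSemidef)
    {D R : Fin L → ℝ} :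
    R ∈ btRegion S D ↔ ∃ q : Fin L → ℝ≥0, IsAdmissible S D q ∧ ∀ A : Finset (Fin L),
      infoNats S (fun i => (q i : ℝ)⁻¹) A ≤ Real.log 2 * ∑ i ∈ A, R i := by
  refine exists_congr fun q => and_congr_right fun hq => forall_congr' fun A => ?_
  obtain ⟨h1, h2⟩ := condMutualInfo_testLaw hS hq.1 A
  have hlog : 0 < Real.log 2 := Real.log_pos one_lt_two
  rw [h1, EReal.coe_ennreal_ofReal, max_eq_left (div_nonneg h2 hlog.le), EReal.coe_le_coe_iff,
    div_le_iff₀' hlog]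

namespace IsBlockDegraded

variable {L K : ℕ} {S : Matrix (Fin L) (Fin L) ℝ} {D : Fin L → ℝ}
  {S' : Matrix (Fin K) (Fin K) ℝ} {D' : Fin K → ℝ}
  {g : Fin L → Fin K} {lead : Fin K → Fin L} {z : Fin L → ℝ}

/-- The leaders contribute through the merged weights. Each noise contributes `log (1 + z j * w j)`,
which for `w j = 1 / q j` is twice the information in nats between `Z_j` and `Z_j + Q_j`. -/
lemma log_det_eq (h : IsBlockDegraded S D S' D' g lead z) (hS : S.PosSemidef) {w : Fin L → ℝ}
    (hw : ∀ j, 0 ≤ w j) :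
    Real.log (1 + S * Matrix.diagonal w).det =
      Real.log (1 + S' * Matrix.diagonal
        fun k => ∑ j, if g j = k then w j / (1 + z j * w j) else 0).det +
      ∑ j, Real.log (1 + z j * w j) := by
  have hp : ∀ j, 0 < 1 + z j * w j := fun j => by
    have := mul_nonneg (h.noise_nonneg j) (hw j)
    positivity
  have hdet : 0 < (1 + S' * Matrix.diagonal
        fun k => ∑ j, if g j = k then w j / (1 + z j * w j) else 0).det := by
    refine det_one_add_mul_diagonal_pos (h.posSemidef' hS) fun k =>
      Finset.sum_nonneg fun j _ => ?_
    split_ifs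
    exacts [div_nonneg (hw j) (hp j).le, le_rfl]
  conv_lhs => rw [h.cov_eq', det_one_add_add_diagonal_mul _ fun j => (hp j).ne',
    det_one_add_submatrix_mul_diagonal]
  rw [Real.log_mul hdet.ne' (Finset.prod_ne_zero_iff.2 fun j _ => (hp j).ne'),
    Real.log_prod fun j _ => (hp j).ne']

/-- By `log_det_eq` the leader terms agree on both sides. The right side has in addition half the
sum of the nonnegative noise terms over the groups in `B`. -/
lemma infoNats_mergedVar_le (h : IsBlockDegraded S D S' D' g lead z) (hS : S.PosSemidef)
    {q : Fin L → ℝ≥0} (hq : ∀ j, 0 < q j) (B : Finset (Fin K)) :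
    infoNats S' (fun k => (mergedVar g z q k : ℝ)⁻¹) B ≤
      infoNats S (fun j => (q j : ℝ)⁻¹) (Finset.univ.filter fun j => g j ∈ B) := by
  have hq' : ∀ j, (0 : ℝ) < q j := fun j => by exact_mod_cast hq j
  have hfrac : ∀ j, (q j : ℝ)⁻¹ / (1 + z j * (q j : ℝ)⁻¹) = ((q j : ℝ) + z j)⁻¹ := fun j => by
    have h1 := hq' j
    have h2 : (q j : ℝ) + z j ≠ 0 := (add_pos_of_pos_of_nonneg h1 (h.noise_nonneg j)).ne'
    field_simp
  have hw : ∀ j, (0 : ℝ) ≤ (q j : ℝ)⁻¹ := fun j => (inv_pos.2 (hq' j)).le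
  simp only [infoNats, Finset.mem_filter, Finset.mem_univ, true_and]
  rw [h.log_det_eq hS hw, h.log_det_eq hS (w := fun j => if g j ∈ B then 0 else (q j : ℝ)⁻¹)
    fun j => by split_ifs; exacts [le_rfl, hw j]]
  have h1 : (fun k => ∑ j, if g j = k then (q j : ℝ)⁻¹ / (1 + z j * (q j : ℝ)⁻¹) else 0) =
      fun k => (mergedVar g z q k : ℝ)⁻¹ := by
    ext k
    rw [h.inv_mergedVar]
    simp_rw [hfrac]
  have h2 : (fun k => ∑ j, if g j = k then (if g j ∈ B then 0 else (q j : ℝ)⁻¹) /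
        (1 + z j * (if g j ∈ B then 0 else (q j : ℝ)⁻¹)) else 0) =
      fun k => if k ∈ B then 0 else (mergedVar g z q k : ℝ)⁻¹ := by
    ext k
    rw [h.inv_mergedVar]
    by_cases hk : k ∈ B
    · rw [if_pos hk]
      refine Finset.sum_eq_zero fun j _ => ?_
      by_cases hj : g j = k <;> simp [hj, hk]
    · rw [if_neg hk]
      refine Finset.sum_congr rfl fun j _ => ?_
      by_cases hj : g j = k
      · simp [hj, hk, hfrac]
      · simp [hj]
  rw [h1, h2]
  have h3 : ∑ j, Real.log (1 + z j * (if g j ∈ B then 0 else (q j : ℝ)⁻¹)) ≤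
      ∑ j, Real.log (1 + z j * (q j : ℝ)⁻¹) := by
    refine Finset.sum_le_sum fun j _ => ?_
    have h4 := mul_nonneg (h.noise_nonneg j) (hw j)
    split_ifs
    · simpa using Real.log_nonneg (by linarith)
    · exact le_rfl
  linarith

/-- Adding the rates within each group preserves the sum-rate. Only the Berger–Tung constraints for
unions of groups are needed. -/
lemma btMinSumRate_induced_le (h : IsBlockDegraded S D S' D' g lead z) (hS : S.PosSemidef) :
    btMinSumRate S' D' ≤ btMinSumRate S D := by
  refine le_iInf₂ fun R hR => ?_
  obtain ⟨q, hq, hA⟩ := (mem_btRegion_iff hS).1 hR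
  have hsum : ∀ B : Finset (Fin K), ∑ k ∈ B, ∑ j with g j = k, R j = ∑ j with g j ∈ B, R j := by
    intro B
    rw [← Finset.sum_fiberwise_of_maps_to (s := Finset.univ.filter fun j => g j ∈ B) (t := B)
      (g := g) fun j hj => (Finset.mem_filter.1 hj).2]
    refine Finset.sum_congr rfl fun k hk => Finset.sum_congr ?_ fun _ _ => rfl
    ext j
    simp only [Finset.mem_filter, Finset.mem_univ, true_and]
    exact ⟨fun hj => ⟨hj ▸ hk, hj⟩, fun hj => hj.2⟩
  have hmem : (fun k => ∑ j with g j = k, R j) ∈ btRegion S' D' := by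
    refine (mem_btRegion_iff (h.posSemidef' hS)).2
      ⟨mergedVar g z q, h.isAdmissible_mergedVar hS hq, fun B => ?_⟩
    rw [hsum]
    exact (h.infoNats_mergedVar_le hS hq.1 B).trans (hA _)
  refine (iInf₂_le _ hmem).trans (le_of_eq ?_)
  have := hsum Finset.univ
  simp only [Finset.mem_univ, Finset.filter_true] at this
  rw [this]

lemma sum_lead_eq (h : IsBlockDegraded S D S' D' g lead z) (x : Fin K → ℝ) (j : Fin L) :
    (∑ k, if lead k = j then x k else 0) = if j = lead (g j) then x (g j) else 0 := by
  split_ifs with hj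
  · rw [Finset.sum_eq_single (g j)]
    · rw [if_pos hj.symm]
    · exact fun k _ hk => if_neg fun hkj => hk (by rw [← hkj, h.lead_mem])
    · simp
  · exact Finset.sum_eq_zero fun k _ => if_neg fun hkj => hj (by rw [← hkj, h.lead_mem])

/-- The limiting case in which non-leaders have infinitely noisy channels. Such a channel is not
itself allowed, so this is only approached in `exists_mem_btRegion`. -/
lemma infoNats_lead (h : IsBlockDegraded S D S' D' g lead z) (x : Fin K → ℝ)
    (A : Finset (Fin L)) :
    infoNats S (fun j => if j = lead (g j) then x (g j) else 0) A =
      infoNats S' x (Finset.univ.filter fun k => lead k ∈ A) := by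
  have hdet : ∀ y : Fin K → ℝ, (1 + S * Matrix.diagonal
      fun j => if j = lead (g j) then y (g j) else 0).det = (1 + S' * Matrix.diagonal y).det := by
    intro y
    rw [← h.submatrix_lead, det_one_add_submatrix_mul_diagonal]
    simp_rw [h.sum_lead_eq]
  have h2 : (fun j => if j ∈ A then 0 else if j = lead (g j) then x (g j) else 0) =
      fun j => if j = lead (g j) then (fun k => if lead k ∈ A then 0 else x k) (g j) else 0 := by
    ext j
    by_cases hj : j = lead (g j)
    · simp only [if_pos hj]
      rw [← hj]
    · simp [hj]
  have h3 := hdet fun k => if lead k ∈ A then 0 else x k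
  simp only [infoNats, h2]
  rw [hdet, h3]
  simp

/-- Both determinants are polynomial in the weights and positive at `t = 0`, so their logarithms are
continuous there. -/
lemma continuousAt_infoNats (hS : S.PosSemidef) {w : ℝ → Fin L → ℝ} (hc : Continuous w)
    (hw : ∀ j, 0 ≤ w 0 j) (A : Finset (Fin L)) :
    ContinuousAt (fun t => infoNats S (w t) A) 0 := by
  have hcj : ∀ j, Continuous fun t => w t j := fun j => (continuous_apply j).comp hc
  have hcA : Continuous fun t => (fun j => if j ∈ A then 0 else w t j : Fin L → ℝ) := by
    refine continuous_pi fun j => ?_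
    by_cases hj : j ∈ A
    · simp only [hj, if_true]; exact continuous_const
    · simp only [hj, if_false]; exact hcj j
  unfold infoNats
  refine (ContinuousAt.sub (ContinuousAt.log ?_ ?_) (ContinuousAt.log ?_ ?_)).div_const 2
  · exact (Continuous.matrix_det (by fun_prop)).continuousAt
  · exact (det_one_add_mul_diagonal_pos hS hw).ne'
  · exact (Continuous.matrix_det (continuous_const.add
      (continuous_const.matrix_mul hcA.matrix_diagonal))).continuousAt
  · refine (det_one_add_mul_diagonal_pos hS fun j => ?_).ne'
    split_ifs
    exacts [le_rfl, hw j]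

lemma exists_mem_btRegion (h : IsBlockDegraded S D S' D' g lead z) (hS : S.PosSemidef)
    {R' : Fin K → ℝ} (hR' : R' ∈ btRegion S' D') {ε : ℝ} (hε : 0 < ε) :
    (fun j => (if j = lead (g j) then R' (g j) else 0) + ε) ∈ btRegion S D := by
  obtain ⟨q', hq', hA⟩ := (mem_btRegion_iff (h.posSemidef' hS)).1 hR'
  have hlog : 0 < Real.log 2 := Real.log_pos one_lt_two
  -- Weights are inverse variances: the leaders keep theirs, and every other channel gets weight
  -- `t`, with `t = 0` meaning infinite noise.
  set w : ℝ → Fin L → ℝ := fun t j => if j = lead (g j) then (q' (g j) : ℝ)⁻¹ else t with hw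
  have hwc : Continuous w := by
    refine continuous_pi fun j => ?_
    by_cases hj : j = lead (g j)
    · simp only [hw, if_pos hj]; exact continuous_const
    · simp only [hw, if_neg hj]; exact continuous_id
  have hw0 : ∀ j, 0 ≤ w 0 j := fun j => by
    simp only [hw]
    split_ifs
    exacts [by positivity, le_rfl]
  have hsum : ∀ A : Finset (Fin L), ∑ j ∈ A, (if j = lead (g j) then R' (g j) else 0) =
      ∑ k with lead k ∈ A, R' k := by
    intro A
    simp_rw [← h.sum_lead_eq]
    rw [Finset.sum_comm, Finset.sum_filter]
    simp
  -- For nonempty `A` the slack `ε` makes the inequality strict at `t = 0`, hence true nearby. The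
  -- empty set has no slack; both sides are zero there.
  have hev : ∀ᶠ t in nhds (0 : ℝ), ∀ A : Finset (Fin L), A.Nonempty → infoNats S (w t) A ≤
      Real.log 2 * ∑ j ∈ A, ((if j = lead (g j) then R' (g j) else 0) + ε) := by
    refine eventually_all.2 fun A => ?_
    by_cases hAn : A.Nonempty
    · have hlt : infoNats S (w 0) A <
          Real.log 2 * ∑ j ∈ A, ((if j = lead (g j) then R' (g j) else 0) + ε) := by
        have h1 : infoNats S (w 0) A = _ := h.infoNats_lead (fun k => (q' k : ℝ)⁻¹) A
        rw [h1, Finset.sum_add_distrib, hsum, mul_add]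
        refine (hA _).trans_lt (lt_add_of_pos_right _ (mul_pos hlog ?_))
        exact Finset.sum_pos (fun _ _ => hε) hAn
      exact ((continuousAt_infoNats hS hwc hw0 A).eventually_lt_const hlt).mono
        fun t ht _ => ht.le
    · exact Eventually.of_forall fun t h => absurd h hAn
  obtain ⟨t, ht, ht0⟩ := ((hev.filter_mono nhdsWithin_le_nhds).and
    (self_mem_nhdsWithin (s := Set.Ioi (0 : ℝ)))).exists
  have ht0' : 0 < t := ht0
  set q : Fin L → ℝ≥0 := fun j => if j = lead (g j) then q' (g j) else t.toNNReal⁻¹ with hq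
  have hqw : (fun j => (q j : ℝ)⁻¹) = w t := by
    ext j
    simp only [hq, hw]
    split_ifs
    · rfl
    · simp [Real.coe_toNNReal _ ht0'.le]
  refine (mem_btRegion_iff hS).2 ⟨q, h.isAdmissible_of_lead hS hq' ?_ ?_, fun A => ?_⟩
  · intro j
    simp only [hq]
    split_ifs
    · exact hq'.1 _
    · exact inv_pos.2 (Real.toNNReal_pos.2 ht0')
  · intro k
    simp [hq, h.lead_mem]
  · rw [hqw]
    rcases A.eq_empty_or_nonempty with rfl | hAn
    · simp [infoNats]
    · exact ht A hAn

lemma btMinSumRate_le_induced (h : IsBlockDegraded S D S' D' g lead z) (hS : S.PosSemidef) :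
    btMinSumRate S D ≤ btMinSumRate S' D' := by
  refine le_iInf₂ fun R' hR' => ?_
  refine EReal.le_of_forall_lt_iff_le.1 fun b hb => ?_
  rw [EReal.coe_lt_coe_iff] at hb
  -- The slack is paid once by each of the `L` encoders; the `+ 1` avoids division by zero when `L =
  -- 0`.
  set ε : ℝ := (b - ∑ k, R' k) / (L + 1) with hε
  have hL : (0 : ℝ) < L + 1 := by positivity
  have hε0 : 0 < ε := div_pos (sub_pos.2 hb) hL
  refine (iInf₂_le _ (h.exists_mem_btRegion hS hR' hε0)).trans ?_
  rw [EReal.coe_le_coe_iff, Finset.sum_add_distrib]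
  have h1 : ∑ j, (if j = lead (g j) then R' (g j) else 0) = ∑ k, R' k := by
    simp_rw [← h.sum_lead_eq]
    rw [Finset.sum_comm]
    simp
  have h2 : ε * (L + 1) = b - ∑ k, R' k := div_mul_cancel₀ _ hL.ne'
  simp only [h1, Finset.sum_const, Finset.card_univ, Fintype.card_fin, nsmul_eq_mul]
  nlinarith

end IsBlockDegraded

section

/-! ### Block codes, concatenation and time sharing -/

variable {L n : ℕ} {S : Matrix (Fin L) (Fin L) ℝ}

instance (S : Matrix (Fin L) (Fin L) ℝ) (n : ℕ) : IsProbabilityMeasure (blockLaw S n) := by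
  unfold blockLaw; infer_instance

/-- There is a scheme of block length `n` whose `j`-th encoder sends at most `r j` bits and whose
`j`-th reconstruction has total mean squared error at most `d j`. -/
def HasScheme (S : Matrix (Fin L) (Fin L) ℝ) (n : ℕ) (r d : Fin L → ℝ) : Prop :=
  ∃ c : Scheme L n, (∀ j, Real.logb 2 (c.M j) ≤ r j) ∧
    ∀ j, ∑ t, ∫ y, (y t j - c.dec j (c.messages y) t) ^ 2 ∂(blockLaw S n) ≤ d j

lemma HasScheme.mono {r d r' d' : Fin L → ℝ} (h : HasScheme S n r d) (hr : ∀ j, r j ≤ r' j)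
    (hd : ∀ j, d j ≤ d' j) : HasScheme S n r' d' :=
  let ⟨c, h1, h2⟩ := h
  ⟨c, fun j => (h1 j).trans (hr j), fun j => (h2 j).trans (hd j)⟩

/-- Messages may be taken from arbitrary finite types. -/
lemma hasScheme_of_fintype {X : Fin L → Type*} [∀ j, Fintype (X j)] [∀ j, MeasurableSpace (X j)]
    [∀ j, MeasurableSingletonClass (X j)] (enc : ∀ j, (Fin n → ℝ) → X j)
    (henc : ∀ j, Measurable (enc j)) (dec : Fin L → (∀ j, X j) → Fin n → ℝ) {r d : Fin L → ℝ}
    (hr : ∀ j, Real.logb 2 (Fintype.card (X j)) ≤ r j)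
    (hd : ∀ j, ∑ t, ∫ y, (y t j - dec j (fun i => enc i fun s => y s i) t) ^ 2 ∂(blockLaw S n)
      ≤ d j) : HasScheme S n r d := by
  refine ⟨⟨fun j => Fintype.card (X j), fun j x => Fintype.equivFin _ (enc j x),
    fun j => (measurable_of_finite _).comp (henc j),
    fun j w => dec j fun i => (Fintype.equivFin _).symm (w i)⟩, hr, fun j => ?_⟩
  simpa [Scheme.messages] using hd j

lemma Scheme.M_pos (c : Scheme L n) (j : Fin L) : 0 < c.M j := Fin.pos (c.enc j 0)

@[fun_prop]
lemma Scheme.measurable_messages (c : Scheme L n) : Measurable c.messages :=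
  measurable_pi_lambda _ fun i => (c.measurable_enc i).comp (by fun_prop)

lemma Scheme.measurable_dec (c : Scheme L n) (j : Fin L) (t : Fin n) :
    Measurable fun y => c.dec j (c.messages y) t :=
  (measurable_of_finite fun w => c.dec j w t).comp c.measurable_messages

lemma memLp_blockLaw (S : Matrix (Fin L) (Fin L) ℝ) (t : Fin n) (j : Fin L) :
    MemLp (fun y : Fin n → EuclideanSpace ℝ (Fin L) => y t j) 2 (blockLaw S n) :=
  (memLp_source S j).comp_measurePreserving
    (measurePreserving_eval (fun _ : Fin n => multivariateGaussian 0 S) t)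

lemma Scheme.memLp_error (c : Scheme L n) (S : Matrix (Fin L) (Fin L) ℝ) (j : Fin L) (t : Fin n) :
    MemLp (fun y => y t j - c.dec j (c.messages y) t) 2 (blockLaw S n) := by
  refine (memLp_blockLaw S t j).sub ?_
  -- There are finitely many message tuples, so the reconstruction is bounded.
  obtain ⟨C, hC⟩ := Set.Finite.bddAbove (Set.finite_range fun w => ‖c.dec j w t‖)
  exact MemLp.of_bound (c.measurable_dec j t).aestronglyMeasurable C
    (ae_of_all _ fun y => hC ⟨_, rfl⟩)

lemma integral_blockLaw_comp {m : ℕ} {e : Fin n → Fin m} (he : e.Injective)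
    {F : (Fin n → EuclideanSpace ℝ (Fin L)) → ℝ} (hF : Measurable F) :
    ∫ y, F (fun t => y (e t)) ∂(blockLaw S m) = ∫ y, F y ∂(blockLaw S n) := by
  have := map_pi_comp_injective (fun _ : Fin m => multivariateGaussian 0 S) he
  rw [blockLaw, blockLaw, ← this, integral_map
    (measurable_pi_lambda _ fun t => measurable_pi_apply (e t)).aemeasurable
    hF.aestronglyMeasurable]

/-- Concatenation: the first `n` and the last `m` samples are coded separately, and each sub-block
has the block law of its own length. Working with total bits and total error makes both additive. -/
lemma HasScheme.add {m : ℕ} {r d r' d' : Fin L → ℝ} (h : HasScheme S n r d)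
    (h' : HasScheme S m r' d') : HasScheme S (n + m) (r + r') (d + d') := by
  obtain ⟨c, hr, hd⟩ := h
  obtain ⟨c', hr', hd'⟩ := h'
  refine hasScheme_of_fintype (X := fun j => Fin (c.M j) × Fin (c'.M j))
    (fun j x => (c.enc j fun t => x (Fin.castAdd m t), c'.enc j fun t => x (Fin.natAdd n t)))
    (fun j => ((c.measurable_enc j).comp (by fun_prop)).prodMk
      ((c'.measurable_enc j).comp (by fun_prop)))
    (fun j w => Fin.append (c.dec j fun i => (w i).1) (c'.dec j fun i => (w i).2))
    (fun j => ?_) (fun j => ?_)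
  · have h1 : (c.M j : ℝ) ≠ 0 := by exact_mod_cast (c.M_pos j).ne'
    have h2 : (c'.M j : ℝ) ≠ 0 := by exact_mod_cast (c'.M_pos j).ne'
    simp only [Fintype.card_prod, Fintype.card_fin, Nat.cast_mul, Pi.add_apply]
    rw [Real.logb_mul h1 h2]
    exact add_le_add (hr j) (hr' j)
  · rw [Fin.sum_univ_add]
    simp only [Fin.append_left, Fin.append_right, Pi.add_apply]
    refine add_le_add (le_trans (le_of_eq ?_) (hd j)) (le_trans (le_of_eq ?_) (hd' j))
    · refine Finset.sum_congr rfl fun t _ => ?_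
      have := c.measurable_dec j t
      exact integral_blockLaw_comp (Fin.castAdd_injective n m)
        (F := fun y => (y t j - c.dec j (c.messages y) t) ^ 2) (by fun_prop)
    · refine Finset.sum_congr rfl fun t _ => ?_
      have := c'.measurable_dec j t
      exact integral_blockLaw_comp (Fin.natAdd_injective m n)
        (F := fun y => (y t j - c'.dec j (c'.messages y) t) ^ 2) (by fun_prop)

/-- The second moment of the `j`-th source. -/
def power (S : Matrix (Fin L) (Fin L) ℝ) (j : Fin L) : ℝ :=
  ∫ y, y j ^ 2 ∂(multivariateGaussian 0 S)

lemma power_nonneg (S : Matrix (Fin L) (Fin L) ℝ) (j : Fin L) : 0 ≤ power S j :=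
  integral_nonneg fun _ => sq_nonneg _

/-- Sending nothing and reconstructing zero. -/
lemma hasScheme_zero (S : Matrix (Fin L) (Fin L) ℝ) (n : ℕ) :
    HasScheme S n 0 fun j => n * power S j := by
  refine hasScheme_of_fintype (X := fun _ => Unit) (fun _ _ => ()) (fun _ => measurable_const)
    (fun _ _ _ => 0) (fun j => by simp) (fun j => ?_)
  have h1 : ∀ t : Fin n, ∫ y, (y t j - 0) ^ 2 ∂(blockLaw S n) = power S j := fun t => by
    simp only [sub_zero]
    exact integral_comp_eval (μ := fun _ : Fin n => multivariateGaussian 0 S) (i := t)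
      (f := fun y => y j ^ 2) (by fun_prop)
  rw [Finset.sum_congr rfl fun t _ => h1 t]
  simp

lemma HasScheme.nsmul {r d : Fin L → ℝ} (h : HasScheme S n r d) (a : ℕ) :
    HasScheme S (a * n) (a • r) (a • d) := by
  induction a with
  | zero =>
    refine (Nat.zero_mul n).symm ▸ (hasScheme_zero S 0).mono (fun j => by simp) fun j => by simp
  | succ a ih =>
    rw [Nat.succ_mul, succ_nsmul, succ_nsmul]
    exact ih.add h

lemma HasScheme.nonneg {r d : Fin L → ℝ} (h : HasScheme S n r d) (j : Fin L) :
    0 ≤ r j ∧ 0 ≤ d j := by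
  obtain ⟨c, hr, hd⟩ := h
  refine ⟨le_trans (Real.logb_nonneg one_lt_two ?_) (hr j),
    le_trans (Finset.sum_nonneg fun t _ => integral_nonneg fun _ => sq_nonneg _) (hd j)⟩
  exact_mod_cast c.M_pos j

lemma hasScheme_mul_iff (hn : 0 < n) {r d : Fin L → ℝ} :
    HasScheme S n (fun j => n * r j) (fun j => n * d j) ↔
      ∃ c : Scheme L n, (∀ j, c.rate j ≤ r j) ∧ ∀ j, c.distortion S j ≤ d j := by
  have hn' : (0 : ℝ) < n := by exact_mod_cast hn
  refine exists_congr fun c => and_congr (forall_congr' fun j => ?_) (forall_congr' fun j => ?_)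
  · rw [Scheme.rate, div_le_iff₀' hn']
  · rw [Scheme.distortion, one_div, inv_mul_le_iff₀ hn']

/-- Repeating a scheme gives schemes of all large block lengths. -/
lemma HasScheme.eventually (hn : 0 < n) {r d : Fin L → ℝ}
    (h : HasScheme S n (fun j => n * r j) (fun j => n * d j)) {ε : ℝ} (hε : 0 < ε) :
    ∀ᶠ m : ℕ in atTop, HasScheme S m (fun j => m * r j) (fun j => m * (d j + ε)) := by
  have hn' : (0 : ℝ) < n := by exact_mod_cast hn
  have hev : ∀ᶠ m : ℕ in atTop, ∀ j, n * power S j ≤ m * ε := by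
    refine eventually_all.2 fun j => ?_
    filter_upwards [eventually_ge_atTop ⌈n * power S j / ε⌉₊] with m hm
    rw [← div_le_iff₀ hε]
    exact Nat.ceil_le.1 hm
  filter_upwards [hev] with m hm
  -- The scheme is repeated `m / n` times. The fewer than `n` remaining samples are reconstructed as
  -- zero, at a bounded total cost that `m * ε` absorbs.
  have h1 := (h.nsmul (m / n)).add (hasScheme_zero S (m % n))
  rw [mul_comm (m / n) n, Nat.div_add_mod] at h1
  have hle : ((m / n : ℕ) : ℝ) * n ≤ m := by exact_mod_cast Nat.div_mul_le_self m n
  refine h1.mono (fun j => ?_) fun j => ?_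
  · have h0 : 0 ≤ r j := nonneg_of_mul_nonneg_right (h.nonneg j).1 hn'
    simp only [Pi.add_apply, nsmul_eq_mul, Pi.mul_apply, Pi.natCast_apply, Pi.zero_apply,
      add_zero]
    rw [← mul_assoc]
    exact mul_le_mul_of_nonneg_right hle h0
  · have h0 : 0 ≤ d j := nonneg_of_mul_nonneg_right (h.nonneg j).2 hn'
    simp only [Pi.add_apply, nsmul_eq_mul, Pi.mul_apply, Pi.natCast_apply]
    rw [← mul_assoc, mul_add]
    refine add_le_add (mul_le_mul_of_nonneg_right hle h0) (le_trans ?_ (hm j))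
    refine mul_le_mul_of_nonneg_right ?_ (power_nonneg S j)
    exact_mod_cast (Nat.mod_lt m hn).le

lemma limsup_le_coe_iff {u : ℕ → ℝ} {a : ℝ} :
    limsup (fun n => ((u n : ℝ) : EReal)) atTop ≤ (a : EReal) ↔
      ∀ ε > 0, ∀ᶠ n in atTop, u n ≤ a + ε := by
  constructor
  · intro h ε hε
    have h1 : limsup (fun n => ((u n : ℝ) : EReal)) atTop < ((a + ε : ℝ) : EReal) :=
      h.trans_lt (by exact_mod_cast lt_add_of_pos_right a hε)
    filter_upwards [Filter.eventually_lt_of_limsup_lt h1] with n hn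
    exact_mod_cast hn.le
  · intro h
    refine EReal.le_of_forall_lt_iff_le.1 fun x hx => limsup_le_of_le (by isBoundedDefault) ?_
    have hx' : a < x := by exact_mod_cast hx
    filter_upwards [h (x - a) (sub_pos.2 hx')] with n hn
    exact_mod_cast hn.trans (by linarith)

/-- A rate tuple is achievable if it is nearly attained at a single block length. -/
lemma isAchievable_iff {D R : Fin L → ℝ} :
    IsAchievable S D R ↔ ∀ ε > 0, ∃ n : ℕ, 0 < n ∧
      HasScheme S n (fun j => n * (R j + ε)) fun j => n * (D j + ε) := by
  constructor
  · rintro ⟨c, hr, hd⟩ ε hε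
    have h1 := eventually_all.2 fun j => limsup_le_coe_iff.1 (hr j) ε hε
    have h2 := eventually_all.2 fun j => limsup_le_coe_iff.1 (hd j) ε hε
    obtain ⟨n, ⟨h1, h2⟩, hn⟩ := ((h1.and h2).and (eventually_gt_atTop 0)).exists
    exact ⟨n, hn, (hasScheme_mul_iff hn).2 ⟨c n, h1, h2⟩⟩
  · intro h
    -- One sequence of schemes must serve every `ε`, so at each length a scheme with nearly minimal
    -- excess is chosen. The term `1 / (n + 1)` is there because the infimum of the excesses need
    -- not be attained.
    have hc : ∀ n : ℕ, ∃ c : Scheme L n, ∀ ε > 0,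
        (∃ c' : Scheme L n, (∀ j, c'.rate j ≤ R j + ε) ∧ ∀ j, c'.distortion S j ≤ D j + ε) →
        (∀ j, c.rate j ≤ R j + (ε + 1 / ((n : ℝ) + 1))) ∧
          ∀ j, c.distortion S j ≤ D j + (ε + 1 / ((n : ℝ) + 1)) := by
      intro n
      set T : Set ℝ := {ε | 0 < ε ∧ ∃ c' : Scheme L n, (∀ j, c'.rate j ≤ R j + ε) ∧
        ∀ j, c'.distortion S j ≤ D j + ε} with hT
      by_cases hne : T.Nonempty
      · obtain ⟨ε₀, ⟨-, c, h1, h2⟩, hlt⟩ := exists_lt_of_csInf_lt hne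
          (lt_add_of_pos_right (sInf T) (Nat.one_div_pos_of_nat (α := ℝ) (n := n)))
        refine ⟨c, fun ε hε hex => ?_⟩
        have hle : sInf T ≤ ε := csInf_le ⟨0, fun x hx => hx.1.le⟩ ⟨hε, hex⟩
        exact ⟨fun j => (h1 j).trans (by linarith), fun j => (h2 j).trans (by linarith)⟩
      · obtain ⟨c, -⟩ := hasScheme_zero S n
        exact ⟨c, fun ε hε hex => absurd ⟨ε, hε, hex⟩ hne⟩
    choose c hc using hc
    have key : ∀ ε > 0, ∀ᶠ n in atTop, (∀ j, (c n).rate j ≤ R j + ε) ∧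
        ∀ j, (c n).distortion S j ≤ D j + ε := by
      intro ε hε
      obtain ⟨n, hn, hs⟩ := h (ε / 4) (by positivity)
      have hs' := hs.eventually hn (ε := ε / 4) (by positivity)
      have hlim : ∀ᶠ n : ℕ in atTop, 1 / ((n : ℝ) + 1) < ε / 2 :=
        tendsto_one_div_add_atTop_nhds_zero_nat.eventually (gt_mem_nhds (by positivity))
      filter_upwards [hs', hlim, eventually_gt_atTop 0] with m h1 h2 h3
      obtain ⟨c', hr, hd⟩ := (hasScheme_mul_iff h3).1 h1
      obtain ⟨h4, h5⟩ := hc m (ε / 2) (by positivity)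
        ⟨c', fun j => (hr j).trans (by linarith), fun j => (hd j).trans (by linarith)⟩
      exact ⟨fun j => (h4 j).trans (by linarith), fun j => (h5 j).trans (by linarith)⟩
    exact ⟨c, fun j => limsup_le_coe_iff.2 fun ε hε => (key ε hε).mono fun n hn => hn.1 j,
      fun j => limsup_le_coe_iff.2 fun ε hε => (key ε hε).mono fun n hn => hn.2 j⟩

lemma HasScheme.isAchievable (hn : 0 < n) {D R : Fin L → ℝ}
    (h : HasScheme S n (fun j => n * R j) fun j => n * D j) : IsAchievable S D R :=
  isAchievable_iff.2 fun _ hε => ⟨n, hn, h.mono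
    (fun _ => mul_le_mul_of_nonneg_left (le_add_of_nonneg_right hε.le) n.cast_nonneg)
    fun _ => mul_le_mul_of_nonneg_left (le_add_of_nonneg_right hε.le) n.cast_nonneg⟩

lemma isAchievable_of_forall_add {D R : Fin L → ℝ}
    (h : ∀ ε > 0, ∃ D' R' : Fin L → ℝ, IsAchievable S D' R' ∧ (∀ j, D' j ≤ D j + ε) ∧
      ∀ j, R' j ≤ R j + ε) : IsAchievable S D R := by
  refine isAchievable_iff.2 fun ε hε => ?_
  obtain ⟨D', R', hA, hD, hR⟩ := h (ε / 2) (half_pos hε)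
  obtain ⟨n, hn, hs⟩ := isAchievable_iff.1 hA (ε / 2) (half_pos hε)
  refine ⟨n, hn, hs.mono (fun j => ?_) fun j => ?_⟩
  · exact mul_le_mul_of_nonneg_left (by linarith [hR j]) n.cast_nonneg
  · exact mul_le_mul_of_nonneg_left (by linarith [hD j]) n.cast_nonneg

/-- Together with convexity this allows distortion tuples to be averaged at fixed rates, as
`isAchievable_induced` requires. -/
lemma isClosed_setOf_isAchievable (S : Matrix (Fin L) (Fin L) ℝ) (R : Fin L → ℝ) :
    IsClosed {D | IsAchievable S D R} := by
  refine isClosed_of_closure_subset fun D hD => isAchievable_of_forall_add fun ε hε => ?_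
  obtain ⟨D', hD', hdist⟩ := Metric.mem_closure_iff.1 hD ε hε
  refine ⟨D', R, hD', fun j => ?_, fun _ => le_add_of_nonneg_right hε.le⟩
  have := (dist_le_pi_dist D D' j).trans_lt hdist
  rw [Real.dist_eq] at this
  linarith [(abs_lt.1 this).1]

lemma IsAchievable.eventually {D R : Fin L → ℝ} (h : IsAchievable S D R) {ε : ℝ} (hε : 0 < ε) :
    ∀ᶠ m : ℕ in atTop, HasScheme S m (fun j => m * (R j + ε)) fun j => m * (D j + ε) := by
  obtain ⟨n, hn, hs⟩ := isAchievable_iff.1 h (ε / 2) (half_pos hε)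
  filter_upwards [hs.eventually hn (half_pos hε)] with m hm
  exact hm.mono (fun j => mul_le_mul_of_nonneg_left (by linarith) m.cast_nonneg)
    fun j => mul_le_mul_of_nonneg_left (by linarith) m.cast_nonneg

/-- Time sharing between schemes of equal rates. -/
lemma convex_setOf_isAchievable (S : Matrix (Fin L) (Fin L) ℝ) (R : Fin L → ℝ) :
    Convex ℝ {D | IsAchievable S D R} := by
  rw [convex_iff_forall_pos]
  intro D hD D' hD' a b ha hb hab
  refine isAchievable_iff.2 fun ε hε => ?_
  have ha1 : a < 1 := by linarith
  have hfl : Tendsto (fun m : ℕ => ⌊a * m⌋₊) atTop atTop :=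
    tendsto_nat_floor_atTop.comp (tendsto_natCast_atTop_atTop.const_mul_atTop ha)
  have hle : ∀ m : ℕ, (⌊a * m⌋₊ : ℝ) ≤ a * m := fun m => Nat.floor_le (by positivity)
  have hle' : ∀ m : ℕ, ⌊a * m⌋₊ ≤ m := fun m => by
    have h1 : (⌊a * m⌋₊ : ℝ) ≤ m :=
      (hle m).trans (mul_le_of_le_one_left m.cast_nonneg ha1.le)
    exact_mod_cast h1
  have hce : Tendsto (fun m : ℕ => m - ⌊a * m⌋₊) atTop atTop := by
    refine (tendsto_natCast_atTop_iff (R := ℝ)).1 (tendsto_atTop_mono (fun m => ?_)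
      (tendsto_natCast_atTop_atTop.const_mul_atTop hb))
    rw [Nat.cast_sub (hle' m)]
    have := hle m
    have : b = 1 - a := by linarith
    subst this
    linarith
  have hev : ∀ᶠ m : ℕ in atTop, ∀ j, |D j| + |D' j| ≤ m * (ε / 2) := by
    refine eventually_all.2 fun j => ?_
    filter_upwards [eventually_ge_atTop ⌈(|D j| + |D' j|) / (ε / 2)⌉₊] with m hm
    rw [← div_le_iff₀ (half_pos hε)]
    exact Nat.ceil_le.1 hm
  obtain ⟨m, ⟨⟨h1, h2⟩, h3⟩, hm⟩ := (((hfl.eventually (hD.eventually (half_pos hε))).and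
    (hce.eventually (hD'.eventually (half_pos hε)))).and hev |>.and (eventually_gt_atTop 0)).exists
  refine ⟨m, hm, ?_⟩
  have h4 := h1.add h2
  rw [Nat.add_sub_cancel' (hle' m)] at h4
  have hfloor := Nat.lt_floor_add_one (a * m)
  have hfloor' := hle m
  refine h4.mono (fun j => ?_) fun j => ?_
  · simp only [Pi.add_apply]
    rw [Nat.cast_sub (hle' m), ← add_mul, add_sub_cancel]
    exact mul_le_mul_of_nonneg_left (by linarith) m.cast_nonneg
  · simp only [Pi.add_apply, Pi.smul_apply, smul_eq_mul]
    rw [Nat.cast_sub (hle' m)]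
    have hb' : b = 1 - a := by linarith
    -- Rounding `a * m` down hands less than one sample from the first scheme to the second. The
    -- resulting change in distortion is bounded independently of `m`.
    have h5 : (a * m - ⌊a * m⌋₊) * (D' j - D j) ≤ |D j| + |D' j| := by
      refine (le_abs_self _).trans ?_
      rw [abs_mul, abs_of_nonneg (sub_nonneg.2 hfloor')]
      refine (mul_le_of_le_one_left (abs_nonneg _) (by linarith)).trans ?_
      rw [add_comm]
      exact abs_sub _ _
    have h6 := h3 j
    rw [hb']
    nlinarith [h5, h6]

end

/-! ### Schemes for a block-degraded pair and for its induced pair -/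

namespace IsBlockDegraded

variable {L K n : ℕ} {S : Matrix (Fin L) (Fin L) ℝ} {D : Fin L → ℝ}
  {S' : Matrix (Fin K) (Fin K) ℝ} {D' : Fin K → ℝ}
  {g : Fin L → Fin K} {lead : Fin K → Fin L} {z : Fin L → ℝ}

/-- The block of all the sources, from the block of the leaders and the block of the noises. -/
def addNoise (g : Fin L → Fin K)
    (p : (Fin n → EuclideanSpace ℝ (Fin K)) × (Fin n → Fin L → ℝ)) :
    Fin n → EuclideanSpace ℝ (Fin L) :=
  fun t => WithLp.toLp 2 fun j => p.1 t (g j) + p.2 t j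

lemma measurable_addNoise (g : Fin L → Fin K) : Measurable (addNoise (n := n) g) :=
  measurable_pi_lambda _ fun t =>
    (by fun_prop : Measurable fun p : EuclideanSpace ℝ (Fin K) × (Fin L → ℝ) =>
      (WithLp.toLp 2 fun j => p.1 (g j) + p.2 j : EuclideanSpace ℝ (Fin L))).comp
      (by fun_prop : Measurable fun p :
        (Fin n → EuclideanSpace ℝ (Fin K)) × (Fin n → Fin L → ℝ) => (p.1 t, p.2 t))

lemma measurePreserving_addNoise (h : IsBlockDegraded S D S' D' g lead z) (hS : S.PosSemidef)
    (n : ℕ) : MeasurePreserving (addNoise g)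
      ((blockLaw S' n).prod (Measure.pi fun _ : Fin n => noiseLaw z)) (blockLaw S n) := by
  refine ⟨measurable_addNoise g, ?_⟩
  have h1 := (measurePreserving_arrowProdEquivProdArrow _ _ (Fin n)
    (fun _ => multivariateGaussian 0 S') (fun _ => noiseLaw z)).map_eq
  have hm : Measurable fun p : EuclideanSpace ℝ (Fin K) × (Fin L → ℝ) =>
      (WithLp.toLp 2 fun j => p.1 (g j) + p.2 j : EuclideanSpace ℝ (Fin L)) := by fun_prop
  rw [blockLaw, blockLaw, ← h1, Measure.map_map (measurable_addNoise g) (by fun_prop),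
    h.multivariateGaussian_eq_map hS]
  have : IsProbabilityMeasure (((multivariateGaussian 0 S').prod (noiseLaw z)).map
      fun p => (WithLp.toLp 2 fun j => p.1 (g j) + p.2 j : EuclideanSpace ℝ (Fin L))) :=
    Measure.isProbabilityMeasure_map hm.aemeasurable
  exact Measure.pi_map_pi fun _ => hm.aemeasurable

lemma ae_noise_lead (h : IsBlockDegraded S D S' D' g lead z) (n : ℕ) :
    ∀ᵐ w ∂(Measure.pi fun _ : Fin n => noiseLaw z), ∀ t k, w t (lead k) = 0 :=
  ae_all_iff.2 fun t => ae_all_iff.2 fun k =>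
    (measurePreserving_eval (fun _ : Fin n => noiseLaw z) t).quasiMeasurePreserving.ae
      (ae_eval_noiseLaw_eq_zero (h.noise_lead k))

lemma integral_sq_add_noise (h : IsBlockDegraded S D S' D' g lead z) (t : Fin n) (j : Fin L)
    (a : ℝ) : ∫ w, (a + w t j) ^ 2 ∂(Measure.pi fun _ : Fin n => noiseLaw z) = a ^ 2 + z j := by
  rw [integral_comp_eval (μ := fun _ : Fin n => noiseLaw z) (i := t)
    (f := fun x => (a + x j) ^ 2)
    (Measurable.aestronglyMeasurable (by fun_prop))]
  have h1 : Integrable (fun x : Fin L → ℝ => x j) (noiseLaw z) :=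
    (memLp_eval_noiseLaw z j).integrable (by norm_num)
  have h2 := (memLp_eval_noiseLaw z j).integrable_sq
  calc _ = ∫ x, (a ^ 2 + (2 * a * x j + x j ^ 2)) ∂(noiseLaw z) :=
        integral_congr_ae (ae_of_all _ fun x => by ring)
    _ = _ := by
        rw [integral_add (integrable_const _) (by exact (h1.const_mul _).add h2),
          integral_add (h1.const_mul _) h2,
          integral_const_mul, integral_eval_noiseLaw, integral_sq_eval_noiseLaw (h.noise_nonneg j)]
        simp

/-- A scheme for the leaders is a scheme for all the sources. -/
lemma hasScheme_of_lead (h : IsBlockDegraded S D S' D' g lead z) (hS : S.PosSemidef)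
    {r d : Fin K → ℝ} (hs : HasScheme S' n r d) :
    HasScheme S n (fun j => ∑ k, if lead k = j then r k else 0) fun j => d (g j) + n * z j := by
  obtain ⟨c, hr, hd⟩ := hs
  -- Terminal `j` sends the messages of all `k` that it leads. For a non-leader this is an empty
  -- product, with one element and rate zero.
  refine hasScheme_of_fintype (X := fun j => ∀ k : {k // lead k = j}, Fin (c.M k))
    (fun j x k => c.enc k x) (fun j => measurable_pi_lambda _ fun k => c.measurable_enc k)
    (fun j w => c.dec (g j) fun k => w (lead k) ⟨k, rfl⟩) (fun j => ?_) (fun j => ?_)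
  · rw [Fintype.card_pi, Nat.cast_prod, Real.logb_prod, ← Finset.sum_filter,
      ← Finset.sum_subtype_eq_sum_filter]
    · simp only [Fintype.card_fin]
      simpa using Finset.sum_le_sum fun (k : {k // lead k = j}) (_ : k ∈ Finset.univ) => hr k
    · intro k _
      simpa using (c.M_pos k).ne'
  · have key : ∀ t : Fin n, ∫ y,
        (y t j - c.dec (g j) (fun k => c.enc k fun s => y s (lead k)) t) ^ 2 ∂(blockLaw S n) =
        (∫ y, (y t (g j) - c.dec (g j) (c.messages y) t) ^ 2 ∂(blockLaw S' n)) + z j := by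
      intro t
      have hmeas : Measurable fun y : Fin n → EuclideanSpace ℝ (Fin L) =>
          (y t j - c.dec (g j) (fun k => c.enc k fun s => y s (lead k)) t) ^ 2 := by
        have h1 : Measurable fun y : Fin n → EuclideanSpace ℝ (Fin L) =>
            (fun k => c.enc k fun s => y s (lead k) : ∀ k, Fin (c.M k)) :=
          measurable_pi_lambda _ fun k => (c.measurable_enc k).comp (by fun_prop)
        have h2 := (measurable_of_finite fun w => c.dec (g j) w t).comp h1
        exact ((by fun_prop : Measurable fun y : Fin n → EuclideanSpace ℝ (Fin L) =>
          y t j).sub h2).pow_const 2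
      have hL : MemLp (fun p : (Fin n → EuclideanSpace ℝ (Fin K)) × (Fin n → Fin L → ℝ) =>
          (p.1 t (g j) - c.dec (g j) (c.messages p.1) t) + p.2 t j) 2
          ((blockLaw S' n).prod (Measure.pi fun _ : Fin n => noiseLaw z)) :=
        ((c.memLp_error S' (g j) t).comp_measurePreserving measurePreserving_fst).add
          (((memLp_eval_noiseLaw z j).comp_measurePreserving
            (measurePreserving_eval (fun _ : Fin n => noiseLaw z) t)).comp_measurePreserving
              measurePreserving_snd)
      rw [← (h.measurePreserving_addNoise hS n).map_eq, integral_map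
        (measurable_addNoise g).aemeasurable hmeas.aestronglyMeasurable]
      calc _ = ∫ p, ((p.1 t (g j) - c.dec (g j) (c.messages p.1) t) + p.2 t j) ^ 2
            ∂((blockLaw S' n).prod (Measure.pi fun _ : Fin n => noiseLaw z)) := by
            refine integral_congr_ae ?_
            filter_upwards [Measure.quasiMeasurePreserving_snd.ae (h.ae_noise_lead n)] with p hp
            have hmsg : c.messages p.1 = fun k => c.enc k fun s => p.1 s k := rfl
            simp only [addNoise, hp, h.lead_mem, add_zero, hmsg]
            ring
        _ = _ := by
            rw [integral_prod _ hL.integrable_sq]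
            simp only [h.integral_sq_add_noise]
            rw [integral_add (c.memLp_error S' (g j) t).integrable_sq (by fun_prop)]
            simp
    rw [Finset.sum_congr rfl fun t _ => key t, Finset.sum_add_distrib]
    simpa using hd (g j)

lemma isAchievable_of_lead (h : IsBlockDegraded S D S' D' g lead z) (hS : S.PosSemidef)
    {R : Fin K → ℝ} (hR : IsAchievable S' D' R) :
    IsAchievable S D fun j => ∑ k, if lead k = j then R k else 0 := by
  refine isAchievable_iff.2 fun ε hε => ?_
  obtain ⟨n, hn, hs⟩ := isAchievable_iff.1 hR ε hε
  refine ⟨n, hn, (h.hasScheme_of_lead hS hs).mono (fun j => ?_) fun j => ?_⟩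
  · rw [h.sum_lead_eq (fun k => n * (R k + ε)), h.sum_lead_eq]
    split_ifs
    · exact le_rfl
    · positivity
  · rw [← mul_add]
    exact mul_le_mul_of_nonneg_left (by linarith [h.dist_ge' j]) n.cast_nonneg

/-- A scheme for all the sources gives schemes for the leaders, in which each encoder simulates
the encoders of its group by adding a fixed noise block. -/
lemma hasScheme_of_noise (h : IsBlockDegraded S D S' D' g lead z) (c : Scheme L n)
    (w : Fin n → Fin L → ℝ) :
    HasScheme S' n (fun k => ∑ j with g j = k, Real.logb 2 (c.M j)) fun k => ∑ t, ∫ y,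
      (addNoise g (y, w) t (lead k) - c.dec (lead k) (c.messages (addNoise g (y, w))) t) ^ 2
        ∂(blockLaw S' n) := by
  refine hasScheme_of_fintype (X := fun k => ∀ j : {j // g j = k}, Fin (c.M j))
    (fun k x j => c.enc j fun t => x t + w t j)
    (fun k => measurable_pi_lambda _ fun j => (c.measurable_enc j).comp (by fun_prop))
    -- The leader's noise vanishes only almost surely. Subtracting it in the decoder makes the error
    -- formula hold for every `w`.
    (fun k m t => c.dec (lead k) (fun j => m (g j) ⟨j, rfl⟩) t - w t (lead k))
    (fun k => le_of_eq ?_) (fun k => le_of_eq ?_)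
  · rw [Fintype.card_pi, Nat.cast_prod, Real.logb_prod, ← Finset.sum_subtype_eq_sum_filter]
    · simp only [Fintype.card_fin]
      simp
    · intro j _
      simpa using (c.M_pos j).ne'
  · refine Finset.sum_congr rfl fun t _ => integral_congr_ae (ae_of_all _ fun y => ?_)
    have hmsg : c.messages (addNoise g (y, w)) =
      fun j => c.enc j fun s => y s (g j) + w s j := rfl
    simp only [hmsg]
    simp only [addNoise, h.lead_mem]
    ring

/-- Averaging over the noise block bounds each leader's distortion separately but does not give one
block that is good for all of them. Instead, every block `w` makes the tuple `e w` achievable at the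
same rates, and the mean of `e` is the tuple of leader distortions of the given code. Closedness and
convexity put this mean in the achievable set; in effect, one shares time between noise blocks. -/
lemma isAchievable_induced (h : IsBlockDegraded S D S' D' g lead z) (hS : S.PosSemidef)
    {R : Fin L → ℝ} (hR : IsAchievable S D R) :
    IsAchievable S' D' fun k => ∑ j with g j = k, R j := by
  refine isAchievable_of_forall_add fun ε hε => ?_
  -- Up to `L` rates, each with excess `δ`, are added within one group; the `+ 1` covers `L = 0`.
  set δ : ℝ := ε / (L + 1) with hδ
  have hδ0 : 0 < δ := by positivity
  have hδL : L * δ ≤ ε := by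
    rw [hδ, mul_div_assoc', div_le_iff₀ (by positivity)]
    nlinarith
  have hδε : δ ≤ ε := div_le_self hε.le (by simp)
  obtain ⟨n, hn, hs⟩ := isAchievable_iff.1 hR δ hδ0
  obtain ⟨c, hr, hd⟩ := (hasScheme_mul_iff hn).1 hs
  have hn' : (0 : ℝ) < n := by exact_mod_cast hn
  set ν := Measure.pi fun _ : Fin n => noiseLaw z with hν
  set F : Fin K → Fin n → (Fin n → EuclideanSpace ℝ (Fin K)) × (Fin n → Fin L → ℝ) → ℝ :=
    fun k t p => (addNoise g p t (lead k) - c.dec (lead k) (c.messages (addNoise g p)) t) ^ 2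
    with hF
  have hmp := h.measurePreserving_addNoise hS n
  have hFi : ∀ k t, Integrable (F k t) ((blockLaw S' n).prod ν) := fun k t =>
    ((c.memLp_error S (lead k) t).comp_measurePreserving hmp).integrable_sq
  have hFint : ∀ k t, ∫ p, F k t p ∂((blockLaw S' n).prod ν) =
      ∫ y, (y t (lead k) - c.dec (lead k) (c.messages y) t) ^ 2 ∂(blockLaw S n) := fun k t => by
    rw [← hmp.map_eq, integral_map hmp.measurable.aemeasurable
      (hmp.map_eq ▸ (c.memLp_error S (lead k) t).integrable_sq.aestronglyMeasurable)]
  set e : (Fin n → Fin L → ℝ) → Fin K → ℝ :=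
    fun w k => (n : ℝ)⁻¹ * ∑ t, ∫ y, F k t (y, w) ∂(blockLaw S' n) with he
  have hei : ∀ k, Integrable (fun w => e w k) ν := fun k =>
    (integrable_finsetSum _ fun t _ => (hFi k t).integral_prod_right).const_mul _
  have hach : ∀ w, IsAchievable S' (e w) fun k => ∑ j with g j = k, c.rate j := fun w =>
    HasScheme.isAchievable hn ((h.hasScheme_of_noise c w).mono
      (fun k => le_of_eq (by
        rw [Finset.mul_sum]
        refine Finset.sum_congr rfl fun j _ => ?_
        rw [Scheme.rate, mul_div_cancel₀ _ hn'.ne']))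
      fun k => le_of_eq (by rw [he, mul_inv_cancel_left₀ hn'.ne']))
  refine ⟨∫ w, e w ∂ν, fun k => ∑ j with g j = k, c.rate j,
    (convex_setOf_isAchievable S' _).integral_mem (isClosed_setOf_isAchievable S' _)
      (ae_of_all _ hach) (Integrable.of_eval hei), fun k => ?_, fun k => ?_⟩
  · rw [eval_integral hei, he]
    simp only
    rw [integral_const_mul, integral_finsetSum _ fun t _ => (hFi k t).integral_prod_right]
    have h1 : ∀ t, ∫ w, ∫ y, F k t (y, w) ∂(blockLaw S' n) ∂ν =
        ∫ y, (y t (lead k) - c.dec (lead k) (c.messages y) t) ^ 2 ∂(blockLaw S n) := fun t => by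
      rw [← hFint, integral_prod_symm _ (hFi k t)]
    rw [Finset.sum_congr rfl fun t _ => h1 t, ← h.dist_lead]
    have h2 := hd (lead k)
    rw [Scheme.distortion, one_div] at h2
    exact h2.trans (by linarith)
  · calc ∑ j with g j = k, c.rate j ≤ ∑ j with g j = k, (R j + δ) :=
          Finset.sum_le_sum fun j _ => hr j
      _ = (∑ j with g j = k, R j) + (Finset.univ.filter fun j => g j = k).card * δ := by
          rw [Finset.sum_add_distrib, Finset.sum_const, nsmul_eq_mul]
      _ ≤ (∑ j with g j = k, R j) + L * δ := by
          gcongr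
          simpa using Finset.card_filter_le (Finset.univ : Finset (Fin L)) fun j => g j = k
      _ ≤ _ := by gcongr

end IsBlockDegraded

/-! ### Comparison of the operational minimum sum-rates -/

/-- Minimum sum-rates are compared by a continuous linear map of the rate tuples that preserves
achievability and the sum-rate. -/
lemma minSumRate_le_of_map {L K : ℕ} {S : Matrix (Fin L) (Fin L) ℝ} {D : Fin L → ℝ}
    {S' : Matrix (Fin K) (Fin K) ℝ} {D' : Fin K → ℝ} (T : (Fin K → ℝ) →L[ℝ] (Fin L → ℝ))
    (hT : ∀ R, IsAchievable S' D' R → IsAchievable S D (T R))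
    (hsum : ∀ R, ∑ j, T R j = ∑ k, R k) : minSumRate S D ≤ minSumRate S' D' := by
  refine le_iInf₂ fun R hR => ?_
  have hmem : T R ∈ rateRegion S D := by
    -- The preimage of a closed convex set under `T` is closed and convex, so it suffices to check
    -- the achievable tuples themselves.
    have hsub : rateRegion S' D' ⊆ T ⁻¹' rateRegion S D :=
      closedConvexHull_min (fun R hR => subset_closedConvexHull (hT R hR))
        (convex_closedConvexHull.linear_preimage T.toLinearMap)
        (isClosed_closedConvexHull.preimage T.continuous)
    exact hsub hR
  refine (iInf₂_le _ hmem).trans (le_of_eq ?_)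
  rw [hsum]

namespace IsBlockDegraded

variable {L K : ℕ} {S : Matrix (Fin L) (Fin L) ℝ} {D : Fin L → ℝ}
  {S' : Matrix (Fin K) (Fin K) ℝ} {D' : Fin K → ℝ}
  {g : Fin L → Fin K} {lead : Fin K → Fin L} {z : Fin L → ℝ}

lemma minSumRate_le_induced (h : IsBlockDegraded S D S' D' g lead z) (hS : S.PosSemidef) :
    minSumRate S D ≤ minSumRate S' D' := by
  refine minSumRate_le_of_map (ContinuousLinearMap.pi fun j =>
    ∑ k, if lead k = j then ContinuousLinearMap.proj k else 0) (fun R hR => ?_) (fun R => ?_)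
  · convert h.isAchievable_of_lead hS hR using 2 with j
    rw [ContinuousLinearMap.pi_apply, sum_apply]
    refine Finset.sum_congr rfl fun k _ => ?_
    split_ifs <;> simp
  · simp only [ContinuousLinearMap.pi_apply, sum_apply]
    rw [Finset.sum_comm]
    refine Finset.sum_congr rfl fun k _ => ?_
    rw [Finset.sum_eq_single (lead k)]
    · simp
    · intro j _ hj
      simp [hj.symm]
    · simp

lemma minSumRate_induced_le (h : IsBlockDegraded S D S' D' g lead z) (hS : S.PosSemidef) :
    minSumRate S' D' ≤ minSumRate S D := by
  refine minSumRate_le_of_map (ContinuousLinearMap.pi fun k =>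
    ∑ j with g j = k, ContinuousLinearMap.proj j) (fun R hR => ?_) (fun R => ?_)
  · convert h.isAchievable_induced hS hR using 2 with k
    simp
  · simp only [ContinuousLinearMap.pi_apply, sum_apply,
      ContinuousLinearMap.proj_apply]
    exact Finset.sum_fiberwise _ _ _

end IsBlockDegraded

end MTCoding

end

theorem lemma6 {L K : ℕ} (S : Matrix (Fin L) (Fin L) ℝ) (D : Fin L → ℝ)
    (S' : Matrix (Fin K) (Fin K) ℝ) (D' : Fin K → ℝ)
    (g : Fin L → Fin K) (lead : Fin K → Fin L) (z : Fin L → ℝ)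
    (hS : S.PosSemidef)
    (hBD : MTCoding.IsBlockDegraded S D S' D' g lead z)
    (htight : MTCoding.minSumRate S' D' = MTCoding.btMinSumRate S' D') :
    MTCoding.minSumRate S D = MTCoding.btMinSumRate S D ∧
      MTCoding.btMinSumRate S D = MTCoding.btMinSumRate S' D' := by
  have hop : MTCoding.minSumRate S D = MTCoding.minSumRate S' D' :=
    le_antisymm (hBD.minSumRate_le_induced hS) (hBD.minSumRate_induced_le hS)
  have hbt : MTCoding.btMinSumRate S D = MTCoding.btMinSumRate S' D' :=
    le_antisymm (hBD.btMinSumRate_le_induced hS) (hBD.btMinSumRate_induced_le hS)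
  exact ⟨by rw [hop, htight, hbt], hbt⟩
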